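/- Let $a$ be a positive integer which is either equal to $1$ or not of the form $q^k$ with $q\in\mathbb{Q}$ and $k\ge 2$. For $N\ge 1$ let $\mathbb{Q}_a(N)\subset\mathbb{C}$ be the field obtained by adjoining to $\mathbb{Q}$ all complex roots of $X^N-a$. For integers $n\ge1$, $k\ge0$ put $\zeta_n=e^{2\pi i/n}$ and let $\sqrt[n]{a^k}$ denote the positive real $n$-th root of $a^k$. For $N=p_1^{e_1}\cdots p_s^{e_s}$ with primes $p_1<\dots<p_s$ and $a\neq 1$ define $$\Delta_a(N)=\left|\mathrm{Nm}_{\mathbb{Q}_a(N)/\mathbb{Q}}\left(\prod_{i=1}^{s}\prod_{t=1}^{e_i}\mathrm{disc}_{\mathbb{Q}_a(p_1^{e_1}\cdots p_{i-1}^{e_{i-1}}p_i^{t})/\mathbb{Q}_a(p_1^{e_1}\cdots p_{i-1}^{e_{i-1}}p_i^{t-1})}\bigl(\{\zeta_{p_i^t}^{l}\sqrt[p_i^t]{a^k}\}_{l,k}\bigr)\right)\right|,$$ where $0\le k\le p_i-1$, and $0\le l\le p_i-2$ if $t=1$, $0\le l\le p_i-1$ if $t\ge2$; the discriminant of a finite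 family is the determinant of its trace matrix. For $a=1$ put $\Delta_1(N)=1$. For $\beta\in\mathbb{Q}_a(N)$ let $M_{a,N}(\beta)$ be the least $n\ge 0$ such that $\Delta_a(N)\beta$ is a sum of $n$ terms (counted with repetition), each of the form $\xi\sqrt[N]{a^j}$ with $\xi$ a root of unity and $0\le j\le N-1$. For an algebraic number $x$ let $\mathcal{M}(x)$ be the mean of $|x'|^2$ over all conjugates $x'$ of $x$ over $\mathbb{Q}$. **Lemma 5.2.** Let $\mu\ge 0$, let $N=p_1p_2\cdots p_\mu$ be the product of the first $\mu$ odd primes (so $N=1$ if $\mu=0$), and let $\beta$ be an algebraic integer in $\mathbb{Q}_a(N)$. Then $\Delta_a(N)\beta$ is a sum of finitely many terms of the above form, so that $M_{a,N}(\beta)$ is defined, and $$\Delta_a(N)^2\,\mathcal{M}(\beta)\ \ge\ 2^{-\mu}M_{a,N}(\beta).$$ -/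

import Mathlib

namespace Kummer

noncomputable section

/-- The field `ℚ_a(N)`, obtained by adjoining all the complex roots of `X ^ N - a` to `ℚ`. -/
def Qa (a N : ℕ) : IntermediateField ℚ ℂ :=
  IntermediateField.adjoin ℚ {z : ℂ | z ^ N = (a : ℂ)}

/-- The primitive `n`-th root of unity `exp (2πi / n)`; these satisfy
`zeta m = zeta N ^ (N / m)` for `m ∣ N`, `N ≠ 0`. -/
def zeta (n : ℕ) : ℂ := Complex.exp (2 * Real.pi * Complex.I / n)

/-- The positive real `n`-th root of `a ^ k`. -/
def realRoot (a n k : ℕ) : ℝ := (a : ℝ) ^ ((k : ℝ) / (n : ℝ))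

theorem Qa_mono (a : ℕ) {m n : ℕ} (h : m ∣ n) (hn : n ≠ 0) : Qa a m ≤ Qa a n := by
  obtain ⟨d, rfl⟩ := h
  have hd : d ≠ 0 := by rintro rfl; simp at hn
  refine IntermediateField.adjoin_le_iff.2 ?_
  intro x hx
  obtain ⟨y, rfl⟩ := IsAlgClosed.exists_pow_nat_eq x (Nat.pos_of_ne_zero hd)
  refine pow_mem (IntermediateField.subset_adjoin ℚ _ ?_) d
  have hx' : (y ^ d) ^ m = (a : ℂ) := hx
  change y ^ (m * d) = (a : ℂ)
  rw [← hx', ← pow_mul, mul_comm]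

theorem realRoot_one_mem (a : ℕ) {n : ℕ} (hn : n ≠ 0) :
    ((realRoot a n 1 : ℝ) : ℂ) ∈ Qa a n := by
  refine IntermediateField.subset_adjoin ℚ _ ?_
  change ((realRoot a n 1 : ℝ) : ℂ) ^ n = (a : ℂ)
  have h : realRoot a n 1 ^ n = (a : ℝ) := by
    simp only [realRoot, Nat.cast_one, one_div]
    exact Real.rpow_inv_natCast_pow (Nat.cast_nonneg a) hn
  exact_mod_cast h

theorem realRoot_mem (a : ℕ) {n : ℕ} (hn : n ≠ 0) (k : ℕ) :
    ((realRoot a n k : ℝ) : ℂ) ∈ Qa a n := by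
  have h : realRoot a n k = realRoot a n 1 ^ k := by
    simp only [realRoot, Nat.cast_one]
    rw [← Real.rpow_natCast, ← Real.rpow_mul (Nat.cast_nonneg a)]
    congr 1
    ring
  rw [h]
  push_cast
  exact pow_mem (realRoot_one_mem a hn) k

theorem zeta_mem (a : ℕ) [NeZero a] {n : ℕ} (hn : n ≠ 0) : zeta n ∈ Qa a n := by
  have hr := realRoot_one_mem a hn
  have ha : (0 : ℝ) < a := Nat.cast_pos.2 (Nat.pos_of_ne_zero (NeZero.ne a))
  have hr0 : ((realRoot a n 1 : ℝ) : ℂ) ≠ 0 := by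
    exact_mod_cast (Real.rpow_pos_of_pos ha _).ne'
  have hz : zeta n ^ n = 1 := (Complex.isPrimitiveRoot_exp n hn).pow_eq_one
  have hrn : ((realRoot a n 1 : ℝ) : ℂ) ^ n = (a : ℂ) := by
    have h : realRoot a n 1 ^ n = (a : ℝ) := by
      simp only [realRoot, Nat.cast_one, one_div]
      exact Real.rpow_inv_natCast_pow (Nat.cast_nonneg a) hn
    exact_mod_cast h
  have hzr : zeta n * ((realRoot a n 1 : ℝ) : ℂ) ∈ Qa a n := by
    refine IntermediateField.subset_adjoin ℚ _ ?_
    change (zeta n * ((realRoot a n 1 : ℝ) : ℂ)) ^ n = (a : ℂ)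
    rw [mul_pow, hz, hrn, one_mul]
  have := div_mem hzr hr
  rwa [mul_div_cancel_right₀ _ hr0] at this

/-- The index set of the family `ζ_{p^t}^l · (a^k)^{1/p^t}`: here `0 ≤ k ≤ p - 1`, and
`0 ≤ l ≤ p - 2` if `t = 1`, while `0 ≤ l ≤ p - 1` if `t ≥ 2`. -/
abbrev StepIndex (p t : ℕ) : Type := Fin (if t = 1 then p - 1 else p) × Fin p

/-- The family `ζ_{p^t}^l · (a^k)^{1/p^t}`, as elements of `ℚ_a(n)` where `p ^ t ∣ n`. -/
def stepFamily (a p t : ℕ) [NeZero a] {n : ℕ} (h : p ^ t ∣ n) (hn : n ≠ 0) :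
    StepIndex p t → Qa a n :=
  fun i => ⟨zeta (p ^ t) ^ (i.1 : ℕ) * ((realRoot a (p ^ t) i.2 : ℝ) : ℂ),
    Qa_mono a h hn (mul_mem (pow_mem (zeta_mem a (ne_zero_of_dvd_ne_zero hn h)) _)
      (realRoot_mem a (ne_zero_of_dvd_ne_zero hn h) _))⟩

/-- The discriminant `disc_{L/K}(b)` (determinant of the trace matrix) of a finite family `b` of
elements of `L`, for subfields `K ≤ L` of `ℂ`. -/
def relDisc {K L : IntermediateField ℚ ℂ} (h : K ≤ L) {ι : Type} [Fintype ι] [DecidableEq ι]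
    (b : ι → L) : K :=
  Algebra.discr K (fun i => (⟨(b i : ℂ), (b i).2⟩ : IntermediateField.extendScalars h))

/-- The product of the prime powers `q ^ v_q(N)` over the primes `q ∣ N` with `q < p`. -/
def below (N p : ℕ) : ℕ := ∏ q ∈ N.primeFactors with q < p, q ^ N.factorization q

theorem below_mul_pow_dvd {N p t : ℕ} (hp : p ∈ N.primeFactors) (ht : t ≤ N.factorization p) :
    below N p * p ^ t ∣ N := by
  have hN : N ≠ 0 := (Nat.mem_primeFactors.1 hp).2.2
  have h1 : below N p * p ^ N.factorization p ∣ N := by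
    have hnot : p ∉ N.primeFactors.filter (· < p) := by simp
    have h2 : below N p * p ^ N.factorization p
        = ∏ q ∈ insert p (N.primeFactors.filter (· < p)), q ^ N.factorization q := by
      rw [Finset.prod_insert hnot, mul_comm]
      rfl
    rw [h2]
    conv_rhs => rw [← Nat.prod_factorization_pow_eq_self hN]
    refine Finset.prod_dvd_prod_of_subset _ _ _ ?_
    intro q hq
    rcases Finset.mem_insert.1 hq with rfl | hq
    · simpa using hp
    · simpa using (Finset.mem_filter.1 hq).1
  exact (mul_dvd_mul_left _ (pow_dvd_pow p ht)).trans h1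

/-- For a prime `p ∣ N` and `0 ≤ s < v_p(N)`, with `m = below N p * p ^ s`: the discriminant
`disc_{ℚ_a(m p) / ℚ_a(m)}` of the family `ζ_{p^t}^l · (a^k)^{1/p^t}`, `t = s + 1`. -/
def stepDisc (a N : ℕ) [NeZero a] (p : N.primeFactors) (s : Fin (N.factorization p)) :
    Qa a (below N p * (p : ℕ) ^ (s : ℕ)) :=
  have hn : below N p * (p : ℕ) ^ ((s : ℕ) + 1) ≠ 0 :=
    ne_zero_of_dvd_ne_zero (Nat.mem_primeFactors.1 p.2).2.2 (below_mul_pow_dvd p.2 s.2)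
  relDisc
    (Qa_mono a (mul_dvd_mul_left (below N p) (pow_dvd_pow (p : ℕ) (Nat.le_succ (s : ℕ)))) hn)
    (stepFamily a p ((s : ℕ) + 1) (Dvd.intro_left (below N p) rfl) hn)

/-- The product of all the discriminants in the tower
`ℚ = ℚ_a(1) ⊆ ℚ_a(p₁) ⊆ ℚ_a(p₁²) ⊆ ⋯ ⊆ ℚ_a(N)`, as an element of `ℚ_a(N)`. -/
def discProd (a N : ℕ) [NeZero a] : Qa a N :=
  ∏ p : N.primeFactors, ∏ s : Fin (N.factorization p),
    IntermediateField.inclusion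
      (Qa_mono a (below_mul_pow_dvd p.2 s.2.le) (Nat.mem_primeFactors.1 p.2).2.2)
      (stepDisc a N p s)

/-- `Δ_a(N)`: the absolute value of the norm from `ℚ_a(N)` to `ℚ` of the product of the
discriminants in the tower; for `a = 1` the convention is `Δ_1(N) = 1`. -/
def Delta (a N : ℕ) [NeZero a] : ℚ :=
  if a = 1 then 1 else |Algebra.norm ℚ (discProd a N)|

/-- `Δ_a(N) β` is a sum of `n` terms, counted with repetition, each of the form `ξ α` with `ξ` a
root of unity and `α` the positive real `N`-th root of `a ^ j` for some `0 ≤ j < N`. -/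
def IsSumOfRoots (a N : ℕ) [NeZero a] (β : ℂ) (n : ℕ) : Prop :=
  ∃ (ξ : Fin n → ℂ) (j : Fin n → Fin N), (∀ i, ∃ k : ℕ, 0 < k ∧ ξ i ^ k = 1) ∧
    (Delta a N : ℂ) * β = ∑ i, ξ i * ((realRoot a N (j i) : ℝ) : ℂ)

/-- `M_{a,N}(β)`: the least number of terms in such a sum. -/
def M (a N : ℕ) [NeZero a] (β : ℂ) : ℕ := sInf {n : ℕ | IsSumOfRoots a N β n}

/-- `𝓜(x)`: the mean of `|x'|²` over the conjugates `x'` of the algebraic number `x`. -/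
def meanSq (x : ℂ) : ℝ :=
  (((minpoly ℚ x).aroots ℂ).map (fun z => ‖z‖ ^ 2)).sum / ((minpoly ℚ x).natDegree : ℝ)

end

end Kummer

/-! If $\Delta_a(N)=0$ the empty sum does. Suppose $\Delta_a(N)\ne 0$ and $a\ne 1$. As $N$ is
squarefree, each prime $p\mid N$ gives one step of the tower. Its discriminant is nonzero, so its
family of $(p-1)p$ elements is linearly independent. This is also the largest possible degree of the
step, so the family is a basis and $[\mathbb{Q}_a(N):\mathbb{Q}]=\varphi(N)N$.

By Cramer's rule, multiplication by the discriminant of a step makes the coordinates of an algebraic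
integer integral. The norms to $\mathbb{Q}$ are integral multiples of these discriminants and, being
rational, pass down to the coefficients. Descending the tower gives $\Delta\beta=\sum_j\alpha_j
a^{j/N}$ with $\alpha_j\in\mathbb{Z}[\zeta_N]$ (`prod_stepNorm_mul_mem`,
`Delta_mul_mem_radicalRing`). For $a=1$, where $\Delta=1$, this is the fact that
$\mathbb{Z}[\zeta_N]$ is the full ring of integers.

Since the degree is maximal, the images of $\zeta_N$ and $a^{1/N}$ under an embedding can be chosen
independently. Parseval over the second choice gives $\mathcal{M}(\Delta\beta)=\sum_j
a^{2j/N}\mathcal{M}(\alpha_j)\ge\sum_j\mathcal{M}(\alpha_j)$ (`le_meanSq_sum_realRoot`). By Cassels'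
bound (`exists_isSumOfUnityRoots_aeval`), each $\alpha_j$ is a sum of at most
$2^\mu\mathcal{M}(\alpha_j)$ roots of unity. Adding over $j$ finishes the proof. -/

namespace Kummer

open Finset Polynomial

/-! ### Sums over roots of unity and Cassels' bound -/

/-- `x` is a sum of `n` roots of unity. -/
def IsSumOfUnityRoots (n : ℕ) (x : ℂ) : Prop :=
  ∃ ξ : Fin n → ℂ, (∀ i, ∃ k : ℕ, 0 < k ∧ ξ i ^ k = 1) ∧ x = ∑ i, ξ i

theorem IsSumOfUnityRoots.sum {m : ℕ} {n : Fin m → ℕ} {x : Fin m → ℂ}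
    (h : ∀ j, IsSumOfUnityRoots (n j) (x j)) : IsSumOfUnityRoots (∑ j, n j) (∑ j, x j) := by
  choose ξ hξ hx using h
  refine ⟨fun i => ξ (finSigmaFinEquiv.symm i).1 (finSigmaFinEquiv.symm i).2,
    fun i => hξ _ _, ?_⟩
  rw [Equiv.sum_comp finSigmaFinEquiv.symm (fun s : (j : Fin m) × Fin (n j) => ξ s.1 s.2),
    Fintype.sum_sigma]
  exact Finset.sum_congr rfl fun j _ => hx j

theorem IsSumOfUnityRoots.mul_left {n : ℕ} {x y : ℂ} (h : IsSumOfUnityRoots n x) {k : ℕ}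
    (hk : 0 < k) (hy : y ^ k = 1) : IsSumOfUnityRoots n (y * x) := by
  obtain ⟨ξ, hξ, rfl⟩ := h
  refine ⟨fun i => y * ξ i, fun i => ?_, by rw [Finset.mul_sum]⟩
  obtain ⟨l, hl, h⟩ := hξ i
  refine ⟨k * l, Nat.mul_pos hk hl, ?_⟩
  rw [mul_pow, pow_mul, hy, one_pow, one_mul, mul_comm k, pow_mul, h, one_pow]

theorem isSumOfUnityRoots_intCast (c : ℤ) : IsSumOfUnityRoots c.natAbs (c : ℂ) := by
  rcases Int.natAbs_eq c with h | h
  · refine ⟨fun _ => 1, fun _ => ⟨1, one_pos, by simp⟩, ?_⟩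
    conv_lhs => rw [h]
    simp
  · refine ⟨fun _ => -1, fun _ => ⟨2, two_pos, by simp⟩, ?_⟩
    conv_lhs => rw [h]
    simp

/-- Multiplication by a primitive root `ζ` permutes the roots, so the sum is fixed by the factor `ζ
^ e`, which is not `1` unless `n ∣ e`. -/
theorem sum_nthRootsFinset_pow {n : ℕ} (hn : 0 < n) (e : ℕ) :
    ∑ y ∈ nthRootsFinset n (1 : ℂ), y ^ e = if n ∣ e then (n : ℂ) else 0 := by
  have hζ := Complex.isPrimitiveRoot_exp n hn.ne'
  set ζ := Complex.exp (2 * Real.pi * Complex.I / n)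
  split_ifs with h
  · have : ∀ y ∈ nthRootsFinset n (1 : ℂ), y ^ e = 1 := by
      intro y hy
      obtain ⟨d, rfl⟩ := h
      rw [pow_mul, (mem_nthRootsFinset hn 1).1 hy, one_pow]
    rw [Finset.sum_congr rfl this]
    simp [hζ.card_nthRootsFinset]
  · have hmul : ζ ^ e * ∑ y ∈ nthRootsFinset n (1 : ℂ), y ^ e
        = ∑ y ∈ nthRootsFinset n (1 : ℂ), y ^ e := by
      rw [Finset.mul_sum]
      have hζ0 : ζ ≠ 0 := hζ.ne_zero hn.ne'
      refine Finset.sum_bij (fun y _ => ζ * y) ?_ ?_ ?_ ?_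
      · intro y hy
        rw [mem_nthRootsFinset hn] at hy ⊢
        rw [mul_pow, hζ.pow_eq_one, hy, one_mul]
      · intro y _ y' _ h
        exact mul_left_cancel₀ hζ0 h
      · intro y hy
        rw [mem_nthRootsFinset hn] at hy
        refine ⟨ζ⁻¹ * y, ?_, by field_simp⟩
        rw [mem_nthRootsFinset hn, mul_pow, inv_pow, hζ.pow_eq_one, hy, inv_one, one_mul]
      · intro y _
        rw [mul_pow]
    have hne : ζ ^ e - 1 ≠ 0 := sub_ne_zero.2 fun h' => h ((hζ.pow_eq_one_iff_dvd e).1 h')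
    refine (mul_eq_zero.1 (?_ : (ζ ^ e - 1) * _ = 0)).resolve_left hne
    rw [sub_mul, hmul, one_mul, sub_self]

/-- Parseval's identity on the group of `n`-th roots of unity. -/
theorem sum_nthRootsFinset_norm_sq {n : ℕ} (hn : 0 < n) (α : Fin n → ℂ) :
    ∑ y ∈ nthRootsFinset n (1 : ℂ), ‖∑ j, α j * y ^ (j : ℕ)‖ ^ 2 = n * ∑ j, ‖α j‖ ^ 2 := by
  have key : ∀ y ∈ nthRootsFinset n (1 : ℂ),
      ((‖∑ j, α j * y ^ (j : ℕ)‖ ^ 2 : ℝ) : ℂ)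
        = ∑ j, ∑ k, α j * (starRingEnd ℂ) (α k) * y ^ ((j : ℕ) + (n - (k : ℕ))) := by
    intro y hy
    have hy1 := (mem_nthRootsFinset hn 1).1 hy
    -- Conjugation inverts `y`; the exponent `n - k` stands for `-k` within the natural numbers.
    have hconj : ∀ k : Fin n, (starRingEnd ℂ) y ^ (k : ℕ) = y ^ (n - (k : ℕ)) := by
      intro k
      have h1 : ‖y‖ = 1 := Complex.norm_eq_one_of_pow_eq_one hy1 hn.ne'
      have h2 : y * (starRingEnd ℂ) y = 1 := by
        rw [Complex.mul_conj, Complex.normSq_eq_norm_sq, h1]; simp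
      have h3 : y ^ (k : ℕ) * y ^ (n - (k : ℕ)) = 1 := by
        rw [← pow_add, Nat.add_sub_cancel' k.2.le, hy1]
      have h4 : y ^ (k : ℕ) * (starRingEnd ℂ) y ^ (k : ℕ) = 1 := by
        rw [← mul_pow, h2, one_pow]
      have h5 : y ^ (k : ℕ) ≠ 0 := left_ne_zero_of_mul_eq_one h3
      exact mul_left_cancel₀ h5 (h4.trans h3.symm)
    push_cast
    rw [← Complex.mul_conj', map_sum, Finset.sum_mul_sum]
    refine Finset.sum_congr rfl fun j _ => Finset.sum_congr rfl fun k _ => ?_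
    rw [map_mul, map_pow, hconj, pow_add]
    ring
  have : ((∑ y ∈ nthRootsFinset n (1 : ℂ), ‖∑ j, α j * y ^ (j : ℕ)‖ ^ 2 : ℝ) : ℂ)
      = ((n * ∑ j, ‖α j‖ ^ 2 : ℝ) : ℂ) := by
    rw [Complex.ofReal_sum, Finset.sum_congr rfl key, Finset.sum_comm]
    push_cast
    rw [Finset.mul_sum]
    refine Finset.sum_congr rfl fun j _ => ?_
    rw [Finset.sum_comm]
    rw [Finset.sum_eq_single j]
    · rw [← Finset.mul_sum, sum_nthRootsFinset_pow hn, if_pos, Complex.mul_conj']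
      · ring
      · rw [Nat.add_sub_cancel' j.2.le]
    · intro k _ hk
      rw [← Finset.mul_sum, sum_nthRootsFinset_pow hn, if_neg, mul_zero]
      rintro ⟨d, hd⟩
      have h1 := j.2
      have h2 := k.2
      have h3 : (j : ℕ) ≠ k := fun h => hk (Fin.ext h.symm)
      -- `j + (n - k)` lies strictly between `0` and `2n`, so a multiple of `n` there is `n` itself,
      -- forcing `j = k`.
      rcases d with _ | _ | d
      · omega
      · omega
      · have : n * (d + 1 + 1) = n * d + n + n := by ring
        have := Nat.zero_le (n * d)
        omega
    · simp
  exact_mod_cast this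

/-- The sum of `|∑ⱼ αⱼ yʲ|²` over the primitive `p`-th roots of unity `y`. -/
theorem sum_primitiveRoots_norm_sq {p : ℕ} (hp : p.Prime) (α : Fin p → ℂ) :
    2 * ∑ y ∈ primitiveRoots p ℂ, ‖∑ j, α j * y ^ (j : ℕ)‖ ^ 2
      = ∑ i, ∑ j, ‖α j - α i‖ ^ 2 := by
  have h1 := sum_nthRootsFinset_norm_sq hp.pos α
  rw [nthRootsFinset_eq_of_prime hp] at h1
  have h2 : ∀ i j : Fin p, ‖α j - α i‖ ^ 2
      = ‖α j‖ ^ 2 + ‖α i‖ ^ 2 - 2 * (α j * (starRingEnd ℂ) (α i)).re := by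
    intro i j
    rw [← Complex.normSq_eq_norm_sq, ← Complex.normSq_eq_norm_sq, ← Complex.normSq_eq_norm_sq,
      Complex.normSq_sub]
  have h3 : ‖∑ j, α j‖ ^ 2 = ∑ i, ∑ j, (α j * (starRingEnd ℂ) (α i)).re := by
    rw [← Complex.normSq_eq_norm_sq, ← Complex.ofReal_re (Complex.normSq _), ← Complex.mul_conj,
      map_sum, Finset.sum_mul_sum, Finset.sum_comm]
    simp
  have h4 : ∑ i : Fin p, ∑ j, ‖α j - α i‖ ^ 2 = 2 * (p * ∑ j, ‖α j‖ ^ 2) - 2 * ‖∑ j, α j‖ ^ 2 := by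
    rw [h3]
    simp only [h2, Finset.sum_sub_distrib, Finset.sum_add_distrib, Finset.sum_const,
      Finset.card_univ, Fintype.card_fin, ← Finset.mul_sum, nsmul_eq_mul]
    ring
  -- For prime `p` the roots are the primitive ones and `1`; the term at `1` is the subtracted `‖∑ α
  -- j‖ ^ 2`.
  rw [h4, ← h1, Finset.sum_union]
  · rw [Finset.sum_singleton]
    simp only [one_pow, mul_one]
    ring
  · rw [Finset.disjoint_singleton_right]
    intro h
    exact (isPrimitiveRoot_of_mem_primitiveRoots h).ne_one hp.one_lt rfl

/-- Multiplication of pairs is injective because the orders are coprime, and it is onto by counting: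
`φ(m) φ(n) = φ(m n)`. -/
theorem sum_primitiveRoots_mul {m n : ℕ} (hm : 0 < m) (hn : 0 < n) (h : m.Coprime n) (f : ℂ → ℝ) :
    ∑ z ∈ primitiveRoots (m * n) ℂ, f z
      = ∑ x ∈ primitiveRoots m ℂ, ∑ y ∈ primitiveRoots n ℂ, f (x * y) := by
  rw [← Finset.sum_product']
  symm
  have hmn := Nat.mul_pos hm hn
  have hinj : Set.InjOn (fun q : ℂ × ℂ => q.1 * q.2)
      (primitiveRoots m ℂ ×ˢ primitiveRoots n ℂ : Finset (ℂ × ℂ)) := by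
    rintro ⟨x, y⟩ hq ⟨x', y'⟩ hq' (he : x * y = x' * y')
    simp only [Finset.coe_product, Set.mem_prod, Finset.mem_coe, mem_primitiveRoots hm,
      mem_primitiveRoots hn] at hq hq'
    have hx'0 : x' ≠ 0 := hq'.1.ne_zero hm.ne'
    have hy0 : y ≠ 0 := hq.2.ne_zero hn.ne'
    have hq1 : x / x' = y' / y := by
      rw [div_eq_div_iff hx'0 hy0, he, mul_comm]
    have h1 : (x / x') ^ m = 1 := by
      rw [div_pow, hq.1.pow_eq_one, hq'.1.pow_eq_one, div_one]
    have h2 : (x / x') ^ n = 1 := by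
      rw [hq1, div_pow, hq.2.pow_eq_one, hq'.2.pow_eq_one, div_one]
    have h3 : x / x' = 1 := by
      have := pow_gcd_eq_one.2 ⟨h1, h2⟩
      rwa [h.gcd_eq_one, pow_one] at this
    have h4 : x = x' := (div_eq_one_iff_eq hx'0).1 h3
    have h5 : y = y' := by
      rw [hq1, div_eq_one_iff_eq hy0] at h3
      exact h3.symm
    rw [h4, h5]
  have hmem : ∀ q ∈ primitiveRoots m ℂ ×ˢ primitiveRoots n ℂ,
      q.1 * q.2 ∈ primitiveRoots (m * n) ℂ := by
    intro q hq
    rw [Finset.mem_product, mem_primitiveRoots hm, mem_primitiveRoots hn] at hq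
    rw [mem_primitiveRoots hmn]
    have h1 := hq.1.eq_orderOf
    have h2 := hq.2.eq_orderOf
    rw [IsPrimitiveRoot.iff_orderOf, (Commute.all q.1 q.2).orderOf_mul_eq_mul_orderOf_of_coprime
      (by rwa [← h1, ← h2]), ← h1, ← h2]
  have himg : (primitiveRoots m ℂ ×ˢ primitiveRoots n ℂ).image (fun q : ℂ × ℂ => q.1 * q.2)
      = primitiveRoots (m * n) ℂ := by
    refine Finset.eq_of_subset_of_card_le ?_ ?_
    · intro z hz
      obtain ⟨q, hq, rfl⟩ := Finset.mem_image.1 hz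
      exact hmem q hq
    · rw [Finset.card_image_of_injOn hinj, Finset.card_product,
        (Complex.isPrimitiveRoot_exp m hm.ne').card_primitiveRoots,
        (Complex.isPrimitiveRoot_exp n hn.ne').card_primitiveRoots,
        (Complex.isPrimitiveRoot_exp (m * n) hmn.ne').card_primitiveRoots, Nat.totient_mul h]
  rw [← himg, Finset.sum_image hinj]

theorem exists_mul_of_mem_primitiveRoots {m n : ℕ} (hm : 0 < m) (hn : 0 < n) (h : m.Coprime n)
    {z : ℂ} (hz : z ∈ primitiveRoots (m * n) ℂ) :
    ∃ x ∈ primitiveRoots m ℂ, ∃ y ∈ primitiveRoots n ℂ, z = x * y := by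
  by_contra! hc
  -- The indicator function of `z` turns the summation formula into surjectivity of multiplication.
  have h1 := sum_primitiveRoots_mul hm hn h (fun w => if w = z then 1 else 0)
  rw [Finset.sum_ite_eq' _ _ _, if_pos hz, Finset.sum_eq_zero] at h1
  · exact one_ne_zero h1
  · intro x hx
    refine Finset.sum_eq_zero fun y hy => if_neg fun he => hc x hx y hy he.symm

/-- The part of `P` of the exponents that are congruent to `j` modulo `p`. -/
noncomputable def residuePart (p : ℕ) (P : ℤ[X]) (j : Fin p) : ℤ[X] :=
  ∑ k ∈ P.support with k % p = (j : ℕ), monomial k (P.coeff k)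

theorem aeval_mul_eq_sum_residuePart {p : ℕ} (hp : 0 < p) (P : ℤ[X]) (x : ℂ) {y : ℂ}
    (hy : y ^ p = 1) :
    aeval (x * y) P = ∑ j, aeval x (residuePart p P j) * y ^ (j : ℕ) := by
  have h1 : ∀ j : Fin p, aeval x (residuePart p P j) * y ^ (j : ℕ)
      = ∑ k ∈ P.support with (⟨k % p, Nat.mod_lt k hp⟩ : Fin p) = j,
          (P.coeff k : ℂ) * (x * y) ^ k := by
    intro j
    simp only [residuePart, map_sum, aeval_monomial, Finset.sum_mul, Fin.ext_iff]
    refine Finset.sum_congr rfl fun k hk => ?_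
    rw [← (Finset.mem_filter.1 hk).2, mul_pow, ← pow_mod_orderOf y k, ← pow_mod_orderOf y (k % p),
      Nat.mod_mod_of_dvd k (orderOf_dvd_of_pow_eq_one hy)]
    simp [mul_assoc]
  rw [Finset.sum_congr rfl fun j _ => h1 j, Finset.sum_fiberwise, aeval_def,
    eval₂_eq_sum, Polynomial.sum_def]
  rfl

/-- Cassels' bound for the number of roots of unity needed to write an element of `ℤ[ζ_N]`, with `N`
a product of `μ` distinct primes, in terms of its mean square. -/
theorem exists_isSumOfUnityRoots_aeval {p : ℕ → ℕ} (hp : ∀ r, (p r).Prime)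
    (hinj : Function.Injective p) (μ : ℕ) (P : ℤ[X]) {z : ℂ}
    (hz : z ∈ primitiveRoots (∏ r ∈ range μ, p r) ℂ) :
    ∃ n : ℕ, IsSumOfUnityRoots n (aeval z P) ∧
      (n : ℝ) * (Nat.totient (∏ r ∈ range μ, p r) : ℝ)
        ≤ 2 ^ μ * ∑ w ∈ primitiveRoots (∏ r ∈ range μ, p r) ℂ, ‖aeval w P‖ ^ 2 := by
  induction μ generalizing P z with
  | zero =>
    simp only [Finset.range_zero, Finset.prod_empty, IsPrimitiveRoot.primitiveRoots_one,
      Finset.mem_singleton] at hz ⊢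
    subst hz
    have h : aeval (1 : ℂ) P = ((P.eval 1 : ℤ) : ℂ) := by
      have := aeval_algebraMap_apply ℂ (1 : ℤ) P
      simpa using this
    refine ⟨(P.eval 1).natAbs, h ▸ isSumOfUnityRoots_intCast _, ?_⟩
    rw [Finset.sum_singleton, h, Complex.norm_intCast, Nat.totient_one, Nat.cast_one, mul_one,
      pow_zero, one_mul, sq_abs, Nat.cast_natAbs]
    -- An integer `c` needs `|c| ≤ c ^ 2` terms `±1`.
    exact_mod_cast Int.natAbs_le_self_sq _
  | succ μ ih =>
    rw [Finset.prod_range_succ] at hz ⊢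
    set m := ∏ r ∈ range μ, p r
    set q := p μ
    have hq : q.Prime := hp μ
    have hm : 0 < m := Finset.prod_pos fun r _ => (hp r).pos
    have hmq : m.Coprime q := Nat.Coprime.prod_left fun r hr =>
      (Nat.coprime_primes (hp r) hq).2 fun h => (Finset.mem_range.1 hr).ne (hinj h)
    obtain ⟨x, hx, y, hy, rfl⟩ := exists_mul_of_mem_primitiveRoots hm hq.pos hmq hz
    have hpow : ∀ y ∈ primitiveRoots q ℂ, y ^ q = 1 := fun y hy =>
      (isPrimitiveRoot_of_mem_primitiveRoots hy).pow_eq_one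
    set A := residuePart q P
    -- `T i` is the total cost of the coefficients once `A i` has been subtracted from all of them.
    -- The `i` chosen below minimizes it, hence is at most the average.
    set T : Fin q → ℝ := fun i =>
      ∑ j, ∑ w ∈ primitiveRoots m ℂ, ‖aeval w (A j - A i)‖ ^ 2
    have hT : ∑ i, T i = 2 * ∑ w ∈ primitiveRoots (m * q) ℂ, ‖aeval w P‖ ^ 2 := by
      rw [sum_primitiveRoots_mul hm hq.pos hmq, Finset.mul_sum]
      have h1 : ∀ w : ℂ, 2 * ∑ y ∈ primitiveRoots q ℂ, ‖aeval (w * y) P‖ ^ 2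
          = ∑ i, ∑ j, ‖aeval w (A j - A i)‖ ^ 2 := by
        intro w
        simp only [map_sub]
        rw [← sum_primitiveRoots_norm_sq hq]
        congr 1
        refine Finset.sum_congr rfl fun y hy => ?_
        rw [aeval_mul_eq_sum_residuePart hq.pos P w (hpow y hy)]
      simp only [h1]
      exact (Finset.sum_congr rfl fun i _ => Finset.sum_comm).trans Finset.sum_comm
    have : NeZero q := ⟨hq.ne_zero⟩
    obtain ⟨i, -, hi⟩ := Finset.exists_min_image Finset.univ T Finset.univ_nonempty
    have hi' : q * T i ≤ 2 * ∑ w ∈ primitiveRoots (m * q) ℂ, ‖aeval w P‖ ^ 2 := by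
      rw [← hT]
      have := Finset.card_nsmul_le_sum Finset.univ T (T i) (fun j hj => hi j hj)
      simpa using this
    choose n hn hle using fun j => ih (A j - A i) hx
    refine ⟨∑ j, n j, ?_, ?_⟩
    -- Because `∑ y ^ j = 0`, a common term can be subtracted from all the coefficients without
    -- changing the value.
    · have hval : aeval (x * y) P = ∑ j : Fin q, y ^ (j : ℕ) * aeval x (A j - A i) := by
        rw [aeval_mul_eq_sum_residuePart hq.pos P x (hpow y hy)]
        have h0 : ∑ j : Fin q, y ^ (j : ℕ) = 0 := by
          rw [Fin.sum_univ_eq_sum_range (fun j => y ^ j)]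
          exact (isPrimitiveRoot_of_mem_primitiveRoots hy).geom_sum_eq_zero hq.one_lt
        simp only [map_sub, mul_sub, Finset.sum_sub_distrib, ← Finset.sum_mul, h0, zero_mul,
          sub_zero]
        exact Finset.sum_congr rfl fun j _ => mul_comm _ _
      rw [hval]
      refine IsSumOfUnityRoots.sum fun j => (hn j).mul_left hq.pos ?_
      rw [← pow_mul, mul_comm, pow_mul, hpow y hy, one_pow]
    · rw [Nat.totient_mul hmq, Nat.totient_prime hq]
      push_cast [hq.one_le]
      have h1 : (∑ j, (n j : ℝ)) * (m.totient : ℝ) ≤ 2 ^ μ * T i := by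
        rw [Finset.sum_mul, Finset.mul_sum]
        exact Finset.sum_le_sum fun j _ => hle j
      have hT0 : 0 ≤ T i := Finset.sum_nonneg fun _ _ => Finset.sum_nonneg fun _ _ => by positivity
      have hq1 : (1 : ℝ) ≤ q := by exact_mod_cast hq.one_le
      calc (∑ j, (n j : ℝ)) * ((m.totient : ℝ) * (q - 1))
          = (∑ j, (n j : ℝ)) * (m.totient : ℝ) * (q - 1) := by ring
        _ ≤ 2 ^ μ * T i * (q - 1) := by gcongr
        _ ≤ 2 ^ μ * (q * T i) := by
          have : (0 : ℝ) ≤ 2 ^ μ * T i := by positivity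
          nlinarith
        _ ≤ 2 ^ μ * (2 * ∑ w ∈ primitiveRoots (m * q) ℂ, ‖aeval w P‖ ^ 2) := by gcongr
        _ = _ := by ring

end Kummer

/-! ### Mean squares as averages over embeddings -/

namespace Kummer

open Finset Polynomial

/-- Embeddings of `F(x)` correspond to the roots of the minimal polynomial, and each extends to `K`
in `[K : F(x)]` ways. -/
theorem sum_algHom_apply_eq {F K : Type*} [Field F] [Field K] [Algebra F K] [Algebra F ℂ]
    [FiniteDimensional F K] [Algebra.IsSeparable F K] (x : K)
    (f : ℂ → ℝ) :
    ∑ σ : K →ₐ[F] ℂ, f (σ x)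
      = Module.finrank (IntermediateField.adjoin F {x}) K
          * (((minpoly F x).aroots ℂ).map f).sum := by
  classical
  have hx : IsIntegral F x := IsIntegral.of_finite F x
  let L := IntermediateField.adjoin F {x}
  have : FiniteDimensional F L := IntermediateField.finiteDimensional_left L
  have : FiniteDimensional L K := IntermediateField.finiteDimensional_right L
  let g : L := IntermediateField.AdjoinSimple.gen F x
  have h1 : ∑ τ : L →ₐ[F] ℂ, f (τ g) = (((minpoly F x).aroots ℂ).map f).sum := by
    have hnd : ((minpoly F x).aroots ℂ).Nodup :=
      nodup_roots (Polynomial.Separable.map (Algebra.IsSeparable.isSeparable F x))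
    rw [Fintype.sum_equiv (IntermediateField.algHomAdjoinIntegralEquiv F hx) _
      (fun r : {r // r ∈ (minpoly F x).aroots ℂ} => f r) ?_]
    · have := Finset.sum_subtype (F := inferInstance) (s := ((minpoly F x).aroots ℂ).toFinset)
        (p := fun r => r ∈ (minpoly F x).aroots ℂ) (fun r => Multiset.mem_toFinset) f
      rw [← this, Finset.sum, Multiset.toFinset_val, hnd.dedup]
    · intro τ
      have := IntermediateField.algHomAdjoinIntegralEquiv_symm_apply_gen F hx
        (IntermediateField.algHomAdjoinIntegralEquiv F hx τ)
      rw [Equiv.symm_apply_apply] at this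
      rw [← this]
  let : ∀ τ : L →ₐ[F] ℂ, Fintype (@AlgHom L K ℂ _ _ _ _ τ.toRingHom.toAlgebra) := fun τ =>
    letI : Algebra L ℂ := τ.toRingHom.toAlgebra
    minpoly.AlgHom.fintype L K ℂ
  rw [Fintype.sum_equiv (algHomEquivSigma (B := L)) (fun σ : K →ₐ[F] ℂ => f (σ x))
    (fun σ => f (σ.1 g)) fun σ => rfl, Fintype.sum_sigma, ← h1, Finset.mul_sum]
  refine Finset.sum_congr rfl fun τ _ => ?_
  let : Algebra L ℂ := τ.toRingHom.toAlgebra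
  have : Algebra.IsSeparable L K := Algebra.isSeparable_tower_top_of_isSeparable F L K
  change ∑ _y : K →ₐ[L] ℂ, f (τ g) = _
  rw [Finset.sum_const, Finset.card_univ, ← AlgHom.card L K ℂ, nsmul_eq_mul]

/-- This allows the mean square to be computed in any finite extension containing `x`, not only in
`ℚ(x)`. -/
theorem finrank_mul_meanSq (K : IntermediateField ℚ ℂ) [FiniteDimensional ℚ K] (x : K) :
    Module.finrank ℚ K * meanSq x = ∑ σ : K →ₐ[ℚ] ℂ, ‖σ x‖ ^ 2 := by
  have hx : IsIntegral ℚ x := IsIntegral.of_finite ℚ x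
  have hm : minpoly ℚ (x : ℂ) = minpoly ℚ x :=
    minpoly.algebraMap_eq (algebraMap K ℂ).injective x
  rw [sum_algHom_apply_eq (F := ℚ) x (fun z => ‖z‖ ^ 2), meanSq, hm,
    ← Module.finrank_mul_finrank ℚ (IntermediateField.adjoin ℚ {x}) K,
    IntermediateField.adjoin.finrank hx]
  have : ((minpoly ℚ x).natDegree : ℝ) ≠ 0 := by
    exact_mod_cast (minpoly.natDegree_pos hx).ne'
  push_cast
  field_simp

section Radical

variable {F K : Type*} [Field F] [Field K] [Algebra F K] [Algebra F ℂ] {n : ℕ} {z ρ : K} {r : ℂ}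

theorem radicalPair_mem (hn : 0 < n) (hz : IsPrimitiveRoot z n) (hr : r ≠ 0)
    {b : F} (hρ : ρ ^ n = algebraMap F K b) (hrb : r ^ n = algebraMap F ℂ b) (σ : K →ₐ[F] ℂ) :
    (σ z, σ ρ / r) ∈ primitiveRoots n ℂ ×ˢ nthRootsFinset n (1 : ℂ) := by
  rw [Finset.mem_product, mem_primitiveRoots hn, mem_nthRootsFinset hn]
  refine ⟨hz.map_of_injective σ.injective, ?_⟩
  rw [div_pow, ← map_pow, hρ, hrb, AlgHom.commutes, ← hrb, div_self (pow_ne_zero n hr)]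

theorem radicalPair_injective (hr : r ≠ 0)
    (hext : ∀ f g : K →ₐ[F] ℂ, f z = g z → f ρ = g ρ → f = g) :
    Function.Injective fun σ : K →ₐ[F] ℂ => (σ z, σ ρ / r) := by
  intro f g h
  simp only [Prod.mk.injEq] at h
  exact hext f g h.1 (by simpa [div_left_inj' hr] using h.2)

theorem card_radicalPairs (hn : 0 < n) :
    (primitiveRoots n ℂ ×ˢ nthRootsFinset n (1 : ℂ)).card = n.totient * n := by
  have h := Complex.isPrimitiveRoot_exp n hn.ne'
  rw [Finset.card_product, h.card_primitiveRoots, h.card_nthRootsFinset]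

theorem finrank_le_of_radical [FiniteDimensional F K] [Algebra.IsSeparable F K]
    (hn : 0 < n) (hz : IsPrimitiveRoot z n) (hr : r ≠ 0)
    {b : F} (hρ : ρ ^ n = algebraMap F K b) (hrb : r ^ n = algebraMap F ℂ b)
    (hext : ∀ f g : K →ₐ[F] ℂ, f z = g z → f ρ = g ρ → f = g) :
    Module.finrank F K ≤ n.totient * n := by
  rw [← AlgHom.card F K ℂ, ← card_radicalPairs hn, ← Finset.card_univ]
  exact Finset.card_le_card_of_injOn _ (fun σ _ => radicalPair_mem hn hz hr hρ hrb σ)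
    (radicalPair_injective hr hext).injOn

/-- The pair `(σ z, σ ρ / r)` determines `σ`; when the degree is as large as the number of possible
pairs, every pair occurs. -/
theorem sum_algHom_of_radical [FiniteDimensional F K] [Algebra.IsSeparable F K]
    (hn : 0 < n) (hz : IsPrimitiveRoot z n) (hr : r ≠ 0)
    {b : F} (hρ : ρ ^ n = algebraMap F K b) (hrb : r ^ n = algebraMap F ℂ b)
    (hext : ∀ f g : K →ₐ[F] ℂ, f z = g z → f ρ = g ρ → f = g)
    (hdim : n.totient * n ≤ Module.finrank F K) (G : ℂ → ℂ → ℝ) :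
    ∑ σ : K →ₐ[F] ℂ, G (σ z) (σ ρ / r)
      = ∑ x ∈ primitiveRoots n ℂ, ∑ y ∈ nthRootsFinset n (1 : ℂ), G x y := by
  classical
  have hinj := radicalPair_injective (F := F) (z := z) hr hext
  have himg : (Finset.univ : Finset (K →ₐ[F] ℂ)).image (fun σ => (σ z, σ ρ / r))
      = primitiveRoots n ℂ ×ˢ nthRootsFinset n (1 : ℂ) := by
    refine Finset.eq_of_subset_of_card_le ?_ ?_
    · intro q hq
      obtain ⟨σ, -, rfl⟩ := Finset.mem_image.1 hq
      exact radicalPair_mem hn hz hr hρ hrb σ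
    · rw [Finset.card_image_of_injective _ hinj, card_radicalPairs hn, Finset.card_univ,
        AlgHom.card F K ℂ]
      exact hdim
  rw [← Finset.sum_product', ← himg, Finset.sum_image hinj.injOn]

end Radical

theorem isPrimitiveRoot_zeta {n : ℕ} (hn : n ≠ 0) : IsPrimitiveRoot (zeta n) n :=
  Complex.isPrimitiveRoot_exp n hn

theorem realRoot_pos (a : ℕ) [NeZero a] (n k : ℕ) : 0 < realRoot a n k :=
  Real.rpow_pos_of_pos (Nat.cast_pos.2 (NeZero.pos a)) _

theorem one_le_realRoot (a : ℕ) [NeZero a] (n k : ℕ) : 1 ≤ realRoot a n k :=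
  Real.one_le_rpow (by exact_mod_cast NeZero.one_le) (by positivity)

theorem realRoot_eq_pow (a n k : ℕ) : realRoot a n k = realRoot a n 1 ^ k := by
  simp only [realRoot, Nat.cast_one]
  rw [← Real.rpow_natCast, ← Real.rpow_mul (Nat.cast_nonneg a)]
  congr 1
  ring

theorem realRoot_mul_left (a : ℕ) {m n : ℕ} (hm : m ≠ 0) :
    realRoot a n 1 = realRoot a (m * n) m := by
  have : (m : ℝ) ≠ 0 := Nat.cast_ne_zero.2 hm
  simp only [realRoot, Nat.cast_mul, Nat.cast_one]
  congr 1
  rw [div_mul_cancel_left₀ this, one_div]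

theorem zeta_mul_left {m : ℕ} (hm : m ≠ 0) (n : ℕ) : zeta n = zeta (m * n) ^ m := by
  have : (m : ℂ) ≠ 0 := Nat.cast_ne_zero.2 hm
  rw [zeta, zeta, ← Complex.exp_nat_mul]
  congr 1
  push_cast
  field_simp

theorem realRoot_one_pow (a : ℕ) {n : ℕ} (hn : n ≠ 0) :
    ((realRoot a n 1 : ℝ) : ℂ) ^ n = (a : ℂ) := by
  have h : realRoot a n 1 ^ n = (a : ℝ) := by
    simp only [realRoot, Nat.cast_one, one_div]
    exact Real.rpow_inv_natCast_pow (Nat.cast_nonneg a) hn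
  exact_mod_cast h

theorem eq_zeta_pow_mul (a : ℕ) [NeZero a] {n : ℕ} (hn : n ≠ 0) {x : ℂ} (hx : x ^ n = a) :
    ∃ i, x = zeta n ^ i * ((realRoot a n 1 : ℝ) : ℂ) := by
  have : NeZero n := ⟨hn⟩
  have hr : ((realRoot a n 1 : ℝ) : ℂ) ≠ 0 := by exact_mod_cast (realRoot_pos a n 1).ne'
  obtain ⟨i, -, hi⟩ := (isPrimitiveRoot_zeta hn).eq_pow_of_pow_eq_one
    (ξ := x / ((realRoot a n 1 : ℝ) : ℂ)) (by
      rw [div_pow, hx, realRoot_one_pow a hn, div_self (NeZero.ne (a : ℂ))])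
  exact ⟨i, by rw [hi, div_mul_cancel₀ _ hr]⟩

theorem algHom_ext_of_radical {F : Type*} [Field F] [Algebra F ℂ] (a : ℕ) [NeZero a] {n : ℕ}
    (hn : n ≠ 0) {K : IntermediateField F ℂ}
    (hK : K = IntermediateField.adjoin F {x : ℂ | x ^ n = (a : ℂ)})
    (hz : zeta n ∈ K) (hr : ((realRoot a n 1 : ℝ) : ℂ) ∈ K) {f g : K →ₐ[F] ℂ}
    (h1 : f ⟨_, hz⟩ = g ⟨_, hz⟩) (h2 : f ⟨_, hr⟩ = g ⟨_, hr⟩) : f = g := by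
  refine IntermediateField.algHom_ext_of_eq_adjoin F hK fun x hx => ?_
  obtain ⟨i, rfl⟩ := eq_zeta_pow_mul a hn hx
  have : ∀ h, (⟨zeta n ^ i * ((realRoot a n 1 : ℝ) : ℂ), h⟩ : K) = ⟨_, hz⟩ ^ i * ⟨_, hr⟩ :=
    fun h => Subtype.ext (by simp)
  rw [this, map_mul, map_mul, map_pow, map_pow, h1, h2]

theorem finiteDimensional_Qa (a : ℕ) {n : ℕ} (hn : n ≠ 0) : FiniteDimensional ℚ (Qa a n) := by
  have hset : {x : ℂ | x ^ n = (a : ℂ)} = (nthRoots n (a : ℂ)).toFinset := by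
    ext x
    simp [mem_nthRoots (Nat.pos_of_ne_zero hn)]
  have : Finite {x : ℂ | x ^ n = (a : ℂ)} := by
    rw [hset]
    exact Finset.finite_toSet _
  refine IntermediateField.finiteDimensional_adjoin fun x hx => ?_
  refine IsIntegral.of_pow (Nat.pos_of_ne_zero hn) ?_
  rw [show x ^ n = (a : ℂ) from hx]
  simpa using isIntegral_algebraMap (R := ℚ) (A := ℂ) (x := (a : ℚ))

/-- The mean square of an integral combination of the powers of `a ^ (1 / n)` over the `n`-th
cyclotomic ring, in the case of maximal degree. -/
theorem le_meanSq_sum_realRoot (a : ℕ) [NeZero a] {n : ℕ} (hn : n ≠ 0)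
    (hdim : n.totient * n ≤ Module.finrank ℚ (Qa a n)) (P : Fin n → ℤ[X]) :
    ∑ j, ∑ z ∈ primitiveRoots n ℂ, ‖aeval z (P j)‖ ^ 2
      ≤ n.totient * meanSq (∑ j, aeval (zeta n) (P j) * ((realRoot a n j : ℝ) : ℂ)) := by
  have := finiteDimensional_Qa a hn
  set r : ℂ := ((realRoot a n 1 : ℝ) : ℂ) with hr_def
  have hr : r ≠ 0 := Complex.ofReal_ne_zero.2 (realRoot_pos a n 1).ne'
  let z : Qa a n := ⟨zeta n, zeta_mem a hn⟩
  let ρ : Qa a n := ⟨r, realRoot_one_mem a hn⟩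
  have hz : IsPrimitiveRoot z n :=
    IsPrimitiveRoot.of_map_of_injective (f := (Qa a n).val) (isPrimitiveRoot_zeta hn)
      (Qa a n).val.injective
  have hρ : ρ ^ n = algebraMap ℚ (Qa a n) a :=
    Subtype.ext (by simpa [ρ] using realRoot_one_pow a hn)
  have hrb : r ^ n = algebraMap ℚ ℂ a := by simpa using realRoot_one_pow a hn
  have hext : ∀ f g : Qa a n →ₐ[ℚ] ℂ, f z = g z → f ρ = g ρ → f = g := fun f g h1 h2 =>
    algHom_ext_of_radical a hn rfl _ _ h1 h2
  have hfr : Module.finrank ℚ (Qa a n) = n.totient * n :=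
    (finrank_le_of_radical (Nat.pos_of_ne_zero hn) hz hr hρ hrb hext).antisymm hdim
  let x : Qa a n := ∑ j : Fin n, aeval z (P j) * ρ ^ (j : ℕ)
  have hx : (x : ℂ) = ∑ j, aeval (zeta n) (P j) * ((realRoot a n j : ℝ) : ℂ) := by
    have : (x : ℂ) = (Qa a n).val x := rfl
    rw [this, map_sum]
    refine Finset.sum_congr rfl fun j _ => ?_
    rw [map_mul, map_pow, realRoot_eq_pow a n j, Complex.ofReal_pow]
    congr 1
    exact (aeval_algHom_apply ((Qa a n).val.restrictScalars ℤ) z (P j)).symm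
  have hσ : ∀ σ : Qa a n →ₐ[ℚ] ℂ, ‖σ x‖ ^ 2
      = ‖∑ j : Fin n, aeval (σ z) (P j) * r ^ (j : ℕ) * (σ ρ / r) ^ (j : ℕ)‖ ^ 2 := by
    intro σ
    congr 2
    rw [map_sum]
    refine Finset.sum_congr rfl fun j _ => ?_
    rw [map_mul, map_pow, mul_assoc, ← mul_pow, mul_div_cancel₀ _ hr]
    congr 1
    exact (aeval_algHom_apply (σ.restrictScalars ℤ) z (P j)).symm
  have h1 := finrank_mul_meanSq (Qa a n) x
  rw [Finset.sum_congr rfl fun σ _ => hσ σ, sum_algHom_of_radical (Nat.pos_of_ne_zero hn) hz hr hρ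
    hrb hext hdim (fun w y => ‖∑ j : Fin n, aeval w (P j) * r ^ (j : ℕ) * y ^ (j : ℕ)‖ ^ 2),
    hfr, hx] at h1
  simp only [sum_nthRootsFinset_norm_sq (Nat.pos_of_ne_zero hn)] at h1
  rw [← Finset.mul_sum] at h1
  have hn0 : (0 : ℝ) < n := by exact_mod_cast Nat.pos_of_ne_zero hn
  push_cast at h1
  rw [mul_comm (n.totient : ℝ), mul_assoc] at h1
  rw [mul_left_cancel₀ hn0.ne' h1, Finset.sum_comm]
  -- After Parseval each term carries the factor `r ^ j` inside the norm; it can be dropped because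
  -- `r ≥ 1`.
  refine Finset.sum_le_sum fun w _ => Finset.sum_le_sum fun j _ => ?_
  rw [norm_mul, norm_pow, mul_pow]
  refine le_mul_of_one_le_right (by positivity) (one_le_pow₀ (one_le_pow₀ ?_))
  rw [hr_def, Complex.norm_real, Real.norm_of_nonneg (realRoot_pos a n 1).le]
  exact one_le_realRoot a n 1

theorem isCyclotomicExtension_adjoin_zeta {n : ℕ} (hn : n ≠ 0) :
    IsCyclotomicExtension {n} ℚ (IntermediateField.adjoin ℚ {zeta n}) := by
  have : NeZero n := ⟨hn⟩
  have hζ := isPrimitiveRoot_zeta hn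
  change IsCyclotomicExtension {n} ℚ (IntermediateField.adjoin ℚ {zeta n}).toSubalgebra
  rw [IntermediateField.adjoin_simple_toSubalgebra_of_isAlgebraic
    (hζ.isIntegral (Nat.pos_of_ne_zero hn)).tower_top.isAlgebraic]
  exact hζ.adjoin_isCyclotomicExtension ℚ

theorem totient_mul_meanSq_aeval_zeta {n : ℕ} (hn : n ≠ 0) (P : ℤ[X]) :
    n.totient * meanSq (aeval (zeta n) P) = ∑ z ∈ primitiveRoots n ℂ, ‖aeval z P‖ ^ 2 := by
  have : NeZero n := ⟨hn⟩
  have hζ := isPrimitiveRoot_zeta hn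
  have := isCyclotomicExtension_adjoin_zeta hn
  set K := IntermediateField.adjoin ℚ {zeta n}
  have := IsCyclotomicExtension.finiteDimensional {n} ℚ K
  have hirr := cyclotomic.irreducible_rat (Nat.pos_of_ne_zero hn)
  let z : K := IntermediateField.AdjoinSimple.gen ℚ (zeta n)
  have hz : IsPrimitiveRoot z n :=
    IsPrimitiveRoot.of_map_of_injective (f := K.val) hζ K.val.injective
  have h1 := finrank_mul_meanSq K (aeval z P)
  have hx : ((aeval z P : K) : ℂ) = aeval (zeta n) P :=
    (aeval_algHom_apply (K.val.restrictScalars ℤ) z P).symm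
  rw [IsCyclotomicExtension.finrank K hirr, hx] at h1
  rw [h1, Fintype.sum_equiv (hz.embeddingsEquivPrimitiveRoots ℂ hirr) _
    (fun w => ‖aeval (w : ℂ) P‖ ^ 2) ?_]
  · exact Finset.sum_coe_sort (primitiveRoots n ℂ) (fun w => ‖aeval w P‖ ^ 2)
  · intro σ
    rw [hz.embeddingsEquivPrimitiveRoots_apply_coe]
    congr 2
    exact (aeval_algHom_apply (σ.restrictScalars ℤ) z P).symm

/-- For `a = 1` no discriminant factor is available, but none is needed: the ring of integers of the
cyclotomic field is `ℤ[ζ_n]`. -/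
theorem exists_aeval_zeta_of_isIntegral {n : ℕ} (hn : n ≠ 0) {x : ℂ} (hx : x ∈ Qa 1 n)
    (hint : IsIntegral ℤ x) : ∃ P : ℤ[X], x = aeval (zeta n) P := by
  have : NeZero n := ⟨hn⟩
  have hζ := isPrimitiveRoot_zeta hn
  have := isCyclotomicExtension_adjoin_zeta hn
  have hle : Qa 1 n ≤ IntermediateField.adjoin ℚ {zeta n} := by
    refine IntermediateField.adjoin_le_iff.2 fun y hy => ?_
    obtain ⟨i, -, rfl⟩ := hζ.eq_pow_of_pow_eq_one (ξ := y) (by simpa using hy)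
    exact pow_mem (IntermediateField.mem_adjoin_simple_self ℚ _) i
  set K := IntermediateField.adjoin ℚ {zeta n}
  let z : K := IntermediateField.AdjoinSimple.gen ℚ (zeta n)
  have hz : IsPrimitiveRoot z n :=
    IsPrimitiveRoot.of_map_of_injective (f := K.val) hζ K.val.injective
  have hcl := IsCyclotomicExtension.Rat.isIntegralClosure_adjoin_singleton hz
  let y : K := ⟨x, hle hx⟩
  have hy : IsIntegral ℤ y :=
    (isIntegral_algHom_iff (K.val.restrictScalars ℤ) K.val.injective).1 hint
  obtain ⟨w, hw⟩ := hcl.isIntegral_iff.1 hy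
  have hmem : y ∈ Algebra.adjoin ℤ {z} := hw ▸ w.2
  rw [Algebra.adjoin_singleton_eq_range_aeval] at hmem
  obtain ⟨P, hP⟩ := hmem
  refine ⟨P, ?_⟩
  have h := congrArg (K.val.restrictScalars ℤ) hP
  exact h.symm.trans (aeval_algHom_apply (K.val.restrictScalars ℤ) z P).symm

end Kummer

/-! ### Discriminants and integral coordinates in one step of the tower -/

namespace Kummer

open Finset Polynomial

/-- Cramer's rule: multiplication by the discriminant makes the coordinates integral. -/
theorem exists_integral_coord_discr_smul {F K ι : Type*} [Field F] [Field K] [Algebra F K]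
    [FiniteDimensional F K] [CharZero F] [CharZero K] [Fintype ι] [DecidableEq ι] {b : ι → K}
    (hb : ∀ i, IsIntegral ℤ (b i)) (hd : Algebra.discr F b ≠ 0)
    (hcard : Module.finrank F K ≤ Fintype.card ι) {x : K} (hx : IsIntegral ℤ x) :
    ∃ c : ι → F, (∀ i, IsIntegral ℤ (c i)) ∧ Algebra.discr F b • x = ∑ i, c i • b i := by
  have hli : LinearIndependent F b := by
    by_contra h
    exact hd (Algebra.discr_zero_of_not_linearIndependent F h)
  let B := basisOfLinearIndependentOfCardEqFinrank' b hli
    (hli.fintype_card_le_finrank.antisymm hcard)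
  have hB : ⇑B = b := coe_basisOfLinearIndependentOfCardEqFinrank' _ _ _
  let T := Algebra.traceMatrix F b
  let v : ι → F := fun i => Algebra.trace F K (x * b i)
  have hT : T.mulVec (B.equivFun x) = v := by
    have := Algebra.traceMatrix_of_basis_mulVec B x
    rwa [hB] at this
  -- The trace matrix sends the coordinates of `x` to `v`, and sends `T.cramer v` to `det T • v`;
  -- since `det T ≠ 0` the two preimages can be compared.
  have hc : T.cramer v = Algebra.discr F b • B.equivFun x := by
    have h1 : T.mulVec (T.cramer v - Algebra.discr F b • B.equivFun x) = 0 := by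
      rw [Matrix.mulVec_sub, Matrix.mulVec_cramer, Matrix.mulVec_smul, hT, Algebra.discr_def,
        sub_self]
    exact sub_eq_zero.1 (Matrix.eq_zero_of_mulVec_eq_zero hd h1)
  have hTint : ∀ i j, IsIntegral ℤ (T i j) := fun i j =>
    Algebra.isIntegral_trace ((hb i).mul (hb j))
  refine ⟨T.cramer v, fun i => ?_, ?_⟩
  · rw [Matrix.cramer_apply]
    refine IsIntegral.det fun k l => ?_
    rw [Matrix.updateCol_apply]
    split_ifs
    · exact Algebra.isIntegral_trace (hx.mul (hb k))
    · exact hTint k l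
  · rw [hc]
    conv_lhs => rw [← B.sum_equivFun x, Finset.smul_sum, hB]
    simp [smul_smul]

/-- The norm of an algebraic integer is an integral multiple of each of its conjugates. -/
theorem exists_integral_mul_eq_norm {F K : Type*} [Field F] [Field K] [Algebra F K] [Algebra F ℂ]
    [FiniteDimensional F K] [Algebra.IsSeparable F K] {y : K} (hy : IsIntegral ℤ y)
    (τ : K →ₐ[F] ℂ) :
    ∃ q : ℂ, IsIntegral ℤ q ∧ algebraMap F ℂ (Algebra.norm F y) = q * τ y := by
  classical
  have h := Algebra.norm_eq_prod_embeddings F ℂ y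
  rw [← Finset.prod_erase_mul Finset.univ _ (Finset.mem_univ τ)] at h
  exact ⟨_, IsIntegral.prod _ fun σ _ => hy.map (σ.toRingHom.toIntAlgHom), h⟩

/-- The cofactor is a quotient of a rational number by an element of `F`, so it stays in `F` and can
be absorbed into coefficients from `F`. -/
theorem exists_integral_mul_eq_norm_inclusion {F K : IntermediateField ℚ ℂ}
    [FiniteDimensional ℚ K] (h : F ≤ K) {d : F} (hd : IsIntegral ℤ d) (hd0 : d ≠ 0) :
    ∃ q ∈ F, IsIntegral ℤ q ∧
      ((Algebra.norm ℚ (IntermediateField.inclusion h d) : ℚ) : ℂ) = q * d := by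
  obtain ⟨q, hq, he⟩ := exists_integral_mul_eq_norm
    (hd.map ((IntermediateField.inclusion h).restrictScalars ℤ)) K.val
  have he' : ((Algebra.norm ℚ (IntermediateField.inclusion h d) : ℚ) : ℂ) = q * d := he
  refine ⟨q, ?_, hq, he'⟩
  have hd1 : (d : ℂ) ≠ 0 := fun h0 => hd0 (Subtype.ext h0)
  rw [(eq_div_iff hd1).2 he'.symm]
  exact div_mem (algebraMap_mem F _) d.2

/-- Bézout writes a root `z` of `X ^ (m * p) - a` as a product of integer powers of `z ^ m` and `z ^
p`, roots of `X ^ p - a` and `X ^ m - a`. -/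
theorem Qa_mul_eq_adjoin (a : ℕ) [NeZero a] {m p : ℕ} (hm : m ≠ 0) (hp : p ≠ 0)
    (hmp : m.Coprime p) (h : Qa a m ≤ Qa a (m * p)) :
    IntermediateField.extendScalars h
      = IntermediateField.adjoin (Qa a m) {x : ℂ | x ^ p = (a : ℂ)} := by
  apply le_antisymm
  · have hle : Qa a (m * p) ≤ (IntermediateField.adjoin (Qa a m)
        {x : ℂ | x ^ p = (a : ℂ)}).restrictScalars ℚ := by
      refine IntermediateField.adjoin_le_iff.2 fun z (hz : z ^ (m * p) = a) => ?_
      have hz0 : z ≠ 0 := by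
        rintro rfl
        rw [zero_pow (Nat.mul_ne_zero hm hp)] at hz
        exact NeZero.ne (a : ℂ) hz.symm
      have h1 : z ^ m ∈ IntermediateField.adjoin (Qa a m) {x : ℂ | x ^ p = (a : ℂ)} :=
        IntermediateField.subset_adjoin _ _ (show (z ^ m) ^ p = a by rw [← pow_mul, hz])
      have h2 : z ^ p ∈ IntermediateField.adjoin (Qa a m) {x : ℂ | x ^ p = (a : ℂ)} := by
        have : z ^ p ∈ Qa a m := IntermediateField.subset_adjoin _ _
          (show (z ^ p) ^ m = a by rw [← pow_mul, mul_comm, hz])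
        exact IntermediateField.algebraMap_mem _ (⟨_, this⟩ : Qa a m)
      have h3 : z = (z ^ m) ^ (m.gcdA p) * (z ^ p) ^ (m.gcdB p) := by
        rw [← zpow_natCast, ← zpow_natCast, ← zpow_mul, ← zpow_mul, ← zpow_add₀ hz0,
          ← Nat.gcd_eq_gcd_ab, hmp.gcd_eq_one, Nat.cast_one, zpow_one]
      change z ∈ IntermediateField.adjoin (Qa a m) {x : ℂ | x ^ p = (a : ℂ)}
      rw [h3]
      exact mul_mem (zpow_mem h1 _) (zpow_mem h2 _)
    exact hle
  · refine IntermediateField.adjoin_le_iff.2 fun z (hz : z ^ p = a) => ?_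
    exact Qa_mono a (Dvd.intro_left m rfl) (Nat.mul_ne_zero hm hp)
      (IntermediateField.subset_adjoin _ _ hz)

theorem finiteDimensional_extendScalars_Qa (a : ℕ) {m n : ℕ} (hn : n ≠ 0)
    (h : Qa a m ≤ Qa a n) :
    FiniteDimensional (Qa a m) (IntermediateField.extendScalars h) := by
  have := finiteDimensional_Qa a hn
  have : FiniteDimensional ℚ (IntermediateField.extendScalars h) := this
  exact FiniteDimensional.right ℚ (Qa a m) (IntermediateField.extendScalars h)

/-- This upper bound is the size of the step family, so independence alone makes that family a
basis. -/
theorem finrank_Qa_mul_prime_le (a : ℕ) [NeZero a] {m p : ℕ} (hm : m ≠ 0) (hp : p.Prime)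
    (hmp : m.Coprime p) (h : Qa a m ≤ Qa a (m * p)) :
    Module.finrank (Qa a m) (IntermediateField.extendScalars h) ≤ (p - 1) * p := by
  have hn : m * p ≠ 0 := Nat.mul_ne_zero hm hp.ne_zero
  have := finiteDimensional_extendScalars_Qa a hn h
  have hmono : Qa a p ≤ Qa a (m * p) := Qa_mono a (Dvd.intro_left m rfl) hn
  have hr : ((realRoot a p 1 : ℝ) : ℂ) ≠ 0 := Complex.ofReal_ne_zero.2 (realRoot_pos a p 1).ne'
  let z : IntermediateField.extendScalars h := ⟨zeta p, hmono (zeta_mem a hp.ne_zero)⟩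
  let ρ : IntermediateField.extendScalars h :=
    ⟨((realRoot a p 1 : ℝ) : ℂ), hmono (realRoot_one_mem a hp.ne_zero)⟩
  have hz : IsPrimitiveRoot z p := IsPrimitiveRoot.of_map_of_injective
    (f := (IntermediateField.extendScalars h).val) (isPrimitiveRoot_zeta hp.ne_zero)
    (IntermediateField.extendScalars h).val.injective
  rw [← Nat.totient_prime hp]
  refine finrank_le_of_radical (z := z) (ρ := ρ) (b := (a : Qa a m)) hp.pos hz hr
    (Subtype.ext ?_) ?_ fun f g h1 h2 => ?_
  · simpa [ρ] using realRoot_one_pow a hp.ne_zero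
  · simpa using realRoot_one_pow a hp.ne_zero
  · exact algHom_ext_of_radical a hp.ne_zero (Qa_mul_eq_adjoin a hm hp.ne_zero hmp h) _ _ h1 h2

theorem isIntegral_zeta_pow_mul_realRoot (a : ℕ) {n : ℕ} (hn : n ≠ 0) (l k : ℕ) :
    IsIntegral ℤ (zeta n ^ l * ((realRoot a n k : ℝ) : ℂ)) := by
  refine (((isPrimitiveRoot_zeta hn).isIntegral (Nat.pos_of_ne_zero hn)).pow l).mul ?_
  rw [realRoot_eq_pow, Complex.ofReal_pow]
  refine IsIntegral.pow (IsIntegral.of_pow (Nat.pos_of_ne_zero hn) ?_) k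
  rw [realRoot_one_pow a hn]
  simpa using isIntegral_algebraMap (R := ℤ) (A := ℂ) (x := (a : ℤ))

theorem isIntegral_stepFamily (a p t : ℕ) [NeZero a] {n : ℕ} (h : p ^ t ∣ n) (hn : n ≠ 0)
    {F : IntermediateField ℚ ℂ} (hle : F ≤ Qa a n) (i : StepIndex p t) :
    IsIntegral ℤ (⟨(stepFamily a p t h hn i : ℂ), (stepFamily a p t h hn i).2⟩ :
      IntermediateField.extendScalars hle) :=
  (isIntegral_algHom_iff ((IntermediateField.extendScalars hle).val.restrictScalars ℤ)
    (IntermediateField.extendScalars hle).val.injective).1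
    (isIntegral_zeta_pow_mul_realRoot a (ne_zero_of_dvd_ne_zero hn h) i.1 i.2)

theorem isIntegral_relDisc_stepFamily (a p t : ℕ) [NeZero a] {m n : ℕ} (h : p ^ t ∣ n)
    (hn : n ≠ 0) (hle : Qa a m ≤ Qa a n) :
    IsIntegral ℤ (relDisc hle (stepFamily a p t h hn)) := by
  have := finiteDimensional_extendScalars_Qa a hn hle
  exact Algebra.discr_isIntegral _ fun i => isIntegral_stepFamily a p t h hn hle i

theorem le_finrank_of_relDisc_ne_zero (a p : ℕ) [NeZero a] {m n : ℕ} (h : p ^ 1 ∣ n) (hn : n ≠ 0)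
    (hle : Qa a m ≤ Qa a n) (hd : relDisc hle (stepFamily a p 1 h hn) ≠ 0) :
    (p - 1) * p ≤ Module.finrank (Qa a m) (IntermediateField.extendScalars hle) := by
  have := finiteDimensional_extendScalars_Qa a hn hle
  by_contra hlt
  refine hd (Algebra.discr_zero_of_not_linearIndependent _ fun hli => hlt ?_)
  simpa [StepIndex] using hli.fintype_card_le_finrank

theorem exists_integral_coord_relDisc_mul (a : ℕ) [NeZero a] {m p : ℕ} (hm : m ≠ 0)
    (hp : p.Prime) (hmp : m.Coprime p) {n : ℕ} (hnm : n = m * p) (h : p ^ 1 ∣ n) (hn : n ≠ 0)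
    (hle : Qa a m ≤ Qa a n) (hd : relDisc hle (stepFamily a p 1 h hn) ≠ 0)
    {x : ℂ} (hx : x ∈ Qa a n) (hint : IsIntegral ℤ x) :
    ∃ c : StepIndex p 1 → Qa a m, (∀ i, IsIntegral ℤ (c i)) ∧
      (relDisc hle (stepFamily a p 1 h hn) : ℂ) * x
        = ∑ i : StepIndex p 1,
          (c i : ℂ) * (zeta p ^ (i.1 : ℕ) * ((realRoot a p i.2 : ℝ) : ℂ)) := by
  subst hnm
  have := finiteDimensional_extendScalars_Qa a hn hle
  have hx' : IsIntegral ℤ (⟨x, hx⟩ : IntermediateField.extendScalars hle) :=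
    (isIntegral_algHom_iff ((IntermediateField.extendScalars hle).val.restrictScalars ℤ)
      (IntermediateField.extendScalars hle).val.injective).1 hint
  obtain ⟨c, hc, he⟩ := exists_integral_coord_discr_smul
    (isIntegral_stepFamily a p 1 h hn hle) hd
    (by simpa [StepIndex] using finrank_Qa_mul_prime_le a hm hp hmp hle) hx'
  refine ⟨c, hc, ?_⟩
  simp only [Algebra.smul_def] at he
  have h1 := congrArg (IntermediateField.extendScalars hle).val he
  rw [map_mul, map_sum] at h1
  refine Eq.trans h1 (Finset.sum_congr rfl fun i _ => ?_)
  simp only [stepFamily, pow_one, map_mul]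
  rfl

end Kummer

/-! ### Climbing the tower: maximal degree and the ring `ℤ[ζ_n, a ^ (1 / n)]` -/

namespace Kummer

open Finset Polynomial

/-- The ring `ℤ[ζ_n, a ^ (1 / n)]`. -/
noncomputable def radicalRing (a n : ℕ) : Subring ℂ :=
  (eval₂RingHom (aeval (R := ℤ) (zeta n)).toRingHom ((realRoot a n 1 : ℝ) : ℂ)).range

theorem zeta_mem_radicalRing (a n : ℕ) : zeta n ∈ radicalRing a n :=
  ⟨C X, by simp⟩

theorem realRoot_one_mem_radicalRing (a n : ℕ) :
    ((realRoot a n 1 : ℝ) : ℂ) ∈ radicalRing a n :=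
  ⟨X, by simp⟩

theorem zeta_mem_radicalRing_of_dvd (a : ℕ) {m n : ℕ} (h : m ∣ n) (hn : n ≠ 0) :
    zeta m ∈ radicalRing a n := by
  obtain ⟨d, rfl⟩ := h
  rw [zeta_mul_left (right_ne_zero_of_mul hn) m, mul_comm d m]
  exact pow_mem (zeta_mem_radicalRing a _) d

theorem realRoot_mem_radicalRing_of_dvd (a : ℕ) {m n : ℕ} (h : m ∣ n) (hn : n ≠ 0) (k : ℕ) :
    ((realRoot a m k : ℝ) : ℂ) ∈ radicalRing a n := by
  obtain ⟨d, rfl⟩ := h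
  rw [realRoot_eq_pow, realRoot_mul_left a (right_ne_zero_of_mul hn), realRoot_eq_pow,
    mul_comm d m, Complex.ofReal_pow, Complex.ofReal_pow]
  exact pow_mem (pow_mem (realRoot_one_mem_radicalRing a _) d) k

/-- Division by the monic polynomial `Y ^ n - a` over `ℤ[X]` brings the exponents of `a ^ (1 / n)`
below `n`. -/
theorem exists_sum_of_mem_radicalRing (a : ℕ) {n : ℕ} (hn : n ≠ 0) {x : ℂ}
    (hx : x ∈ radicalRing a n) :
    ∃ P : Fin n → ℤ[X], x = ∑ j, aeval (zeta n) (P j) * ((realRoot a n j : ℝ) : ℂ) := by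
  obtain ⟨Q, rfl⟩ := hx
  set r : ℂ := ((realRoot a n 1 : ℝ) : ℂ) with hr
  let B : ℤ[X][X] := X ^ n - C (a : ℤ[X])
  have hB : B.Monic := monic_X_pow_sub_C _ hn
  have hroot : B.eval₂ (aeval (R := ℤ) (zeta n)).toRingHom r = 0 := by
    simp [B, hr, realRoot_one_pow a hn]
  have hdeg : (Q %ₘ B).natDegree < n := by
    have h1 : B.natDegree = n := natDegree_X_pow_sub_C
    have h2 : B ≠ 1 := fun h => hn (by rw [← h1, h, natDegree_one])
    exact h1 ▸ natDegree_modByMonic_lt Q hB h2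
  refine ⟨fun j => (Q %ₘ B).coeff j, ?_⟩
  rw [coe_eval₂RingHom, ← eval₂_modByMonic_eq_self_of_root hroot, eval₂_eq_sum_range' _ hdeg,
    Finset.sum_range]
  refine Finset.sum_congr rfl fun j _ => ?_
  rw [realRoot_eq_pow a n j, Complex.ofReal_pow]
  rfl

theorem Qa_one (a : ℕ) : Qa a 1 = ⊥ := by
  refine le_bot_iff.1 (IntermediateField.adjoin_le_iff.2 fun z hz => ?_)
  have h : z = a := by simpa using hz
  rw [h]
  exact natCast_mem _ a

theorem exists_int_of_mem_Qa_one {a : ℕ} {x : ℂ} (hx : x ∈ Qa a 1) (hint : IsIntegral ℤ x) :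
    ∃ c : ℤ, x = c := by
  rw [Qa_one, IntermediateField.mem_bot] at hx
  obtain ⟨q, rfl⟩ := hx
  have hq : IsIntegral ℤ q := (isIntegral_algebraMap_iff (algebraMap ℚ ℂ).injective).1 hint
  obtain ⟨c, rfl⟩ := IsIntegrallyClosed.isIntegral_iff.1 hq
  exact ⟨c, by simp⟩

/-- The norm to `ℚ` of the discriminants of the steps of the tower that belong to `p`. -/
noncomputable def stepNorm (a N : ℕ) [NeZero a] (p : N.primeFactors) : ℚ :=
  Algebra.norm ℚ (∏ s : Fin (N.factorization p), IntermediateField.inclusion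
      (Qa_mono a (below_mul_pow_dvd p.2 s.2.le) (Nat.mem_primeFactors.1 p.2).2.2)
      (stepDisc a N p s))

theorem norm_discProd (a N : ℕ) [NeZero a] :
    Algebra.norm ℚ (discProd a N) = ∏ p : N.primeFactors, stepNorm a N p := by
  rw [discProd, map_prod]
  rfl

section Step

variable {N p : ℕ}

theorem below_ne_zero (N p : ℕ) : below N p ≠ 0 :=
  Finset.prod_ne_zero_iff.2 fun _ hq =>
    pow_ne_zero _ (Nat.prime_of_mem_primeFactors (Finset.mem_filter.1 hq).1).ne_zero

theorem below_coprime (hp : p.Prime) : (below N p).Coprime p :=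
  Nat.Coprime.prod_left fun _ hq => Nat.Coprime.pow_left _ <|
    (Nat.coprime_primes (Nat.prime_of_mem_primeFactors (Finset.mem_filter.1 hq).1) hp).2
      (Finset.mem_filter.1 hq).2.ne

theorem below_zero (N : ℕ) : below N 0 = 1 := by simp [below]

theorem factorization_eq_one_of_mem (hN : Squarefree N) (hp : p ∈ N.primeFactors) :
    N.factorization p = 1 :=
  (hN.natFactorization_le_one p).antisymm ((Nat.prime_of_mem_primeFactors
    hp).factorization_pos_of_dvd hN.ne_zero (Nat.dvd_of_mem_primeFactors hp))

theorem below_succ_of_mem (hN : Squarefree N) (hp : p ∈ N.primeFactors) :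
    below N (p + 1) = below N p * p := by
  have hset : N.primeFactors.filter (· < p + 1) = insert p (N.primeFactors.filter (· < p)) := by
    ext q
    simp only [Finset.mem_filter, Finset.mem_insert]
    constructor
    · rintro ⟨h1, h2⟩
      rcases Nat.lt_succ_iff_lt_or_eq.1 h2 with h | h
      · exact Or.inr ⟨h1, h⟩
      · exact Or.inl h
    · rintro (rfl | ⟨h1, h2⟩)
      · exact ⟨hp, Nat.lt_succ_self _⟩
      · exact ⟨h1, h2.trans (Nat.lt_succ_self _)⟩
  have hnot : p ∉ N.primeFactors.filter (· < p) := by simp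
  rw [below, hset, Finset.prod_insert hnot, factorization_eq_one_of_mem hN hp, pow_one, mul_comm]
  rfl

theorem below_succ_of_notMem (hp : p ∉ N.primeFactors) : below N (p + 1) = below N p := by
  refine Finset.prod_congr (Finset.filter_congr fun q hq => ?_) fun _ _ => rfl
  have : q ≠ p := fun h => hp (h ▸ hq)
  omega

theorem below_eq_self (hN : N ≠ 0) {t : ℕ} (ht : N < t) : below N t = N := by
  conv_rhs => rw [← Nat.prod_factorization_pow_eq_self hN]
  rw [below, Finset.filter_true_of_mem fun q hq => (Nat.le_of_mem_primeFactors hq).trans_lt ht]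
  rfl

/-- For squarefree `N`, the only step of the tower that belongs to `p` is `t = 1`. -/
def firstStep (hN : Squarefree N) (hp : p ∈ N.primeFactors) : Fin (N.factorization p) :=
  ⟨0, factorization_eq_one_of_mem hN hp ▸ Nat.one_pos⟩

theorem stepNorm_eq (a : ℕ) [NeZero a] (hN : Squarefree N) (hp : p ∈ N.primeFactors) :
    stepNorm a N ⟨p, hp⟩ = Algebra.norm ℚ (IntermediateField.inclusion
      (Qa_mono a (below_mul_pow_dvd hp (firstStep hN hp).2.le) hN.ne_zero)
      (stepDisc a N ⟨p, hp⟩ (firstStep hN hp))) := by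
  rw [stepNorm, Fintype.prod_eq_single (firstStep hN hp)]
  intro s hs
  have h1 : (s : ℕ) < 1 := lt_of_lt_of_eq s.2 (factorization_eq_one_of_mem hN hp)
  exact absurd (Fin.ext (Nat.lt_one_iff.1 h1)) hs

theorem stepDisc_ne_zero {a : ℕ} [NeZero a] (hN : Squarefree N) (hp : p ∈ N.primeFactors)
    (hd : stepNorm a N ⟨p, hp⟩ ≠ 0) : stepDisc a N ⟨p, hp⟩ (firstStep hN hp) ≠ 0 := by
  have := finiteDimensional_Qa a hN.ne_zero
  intro h
  rw [stepNorm_eq a hN hp, h, map_zero, Algebra.norm_zero] at hd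
  exact hd rfl

theorem finrank_step (a : ℕ) [NeZero a] (hN : Squarefree N) (hp : p ∈ N.primeFactors)
    (hd : stepNorm a N ⟨p, hp⟩ ≠ 0) :
    Module.finrank ℚ (Qa a (below N p)) * ((p - 1) * p)
      ≤ Module.finrank ℚ (Qa a (below N p * p)) := by
  have h0 : below N p * p ^ 0 = below N p := by simp
  have h1 : below N p * p ^ 1 = below N p * p := by simp
  have h := le_finrank_of_relDisc_ne_zero a p _ _ _ (stepDisc_ne_zero hN hp hd)
  have hle : Qa a (below N p * p ^ 0) ≤ Qa a (below N p * p ^ 1) := by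
    rw [h0, h1]
    exact Qa_mono a (Dvd.intro _ rfl)
      (Nat.mul_ne_zero (below_ne_zero N p) (Nat.prime_of_mem_primeFactors hp).ne_zero)
  have hmul := IntermediateField.finrank_bot_mul_relfinrank hle
  rw [IntermediateField.relfinrank_eq_finrank_of_le hle] at hmul
  have e0 : Module.finrank ℚ (Qa a (below N p * p ^ 0))
      = Module.finrank ℚ (Qa a (below N p)) := by rw [h0]
  have e1 : Module.finrank ℚ (Qa a (below N p * p ^ 1))
      = Module.finrank ℚ (Qa a (below N p * p)) := by rw [h1]
  rw [← e1, ← hmul, ← e0]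
  exact Nat.mul_le_mul_left _ h

theorem stepNorm_mul (a : ℕ) [NeZero a] (hN : Squarefree N) (hp : p ∈ N.primeFactors)
    (hd : stepNorm a N ⟨p, hp⟩ ≠ 0) {x : ℂ} (hx : x ∈ Qa a (below N p * p))
    (hint : IsIntegral ℤ x) :
    ∃ c : StepIndex p 1 → ℂ, (∀ i, c i ∈ Qa a (below N p) ∧ IsIntegral ℤ (c i)) ∧
      (stepNorm a N ⟨p, hp⟩ : ℂ) * x
        = ∑ i : StepIndex p 1,
          c i * (zeta p ^ (i.1 : ℕ) * ((realRoot a p i.2 : ℝ) : ℂ)) := by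
  have := finiteDimensional_Qa a hN.ne_zero
  have hpp := Nat.prime_of_mem_primeFactors hp
  have h0 : below N p * p ^ 0 = below N p := by simp
  have h1 : below N p * p ^ 1 = below N p * p := by simp
  have hd0 := stepDisc_ne_zero hN hp hd
  have hdint : IsIntegral ℤ (stepDisc a N ⟨p, hp⟩ (firstStep hN hp)) :=
    isIntegral_relDisc_stepFamily a p _ _ _ _
  obtain ⟨q, hq, hqint, hqe⟩ := exists_integral_mul_eq_norm_inclusion
    (Qa_mono a (below_mul_pow_dvd hp (firstStep hN hp).2.le) hN.ne_zero) hdint hd0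
  obtain ⟨c, hc, he⟩ := exists_integral_coord_relDisc_mul a (m := below N p * p ^ 0)
    (n := below N p * p ^ 1) (h0.symm ▸ below_ne_zero N p) hpp (h0.symm ▸ below_coprime hpp)
    (by rw [h0, h1]) _ _ _ hd0 (h1.symm ▸ hx) hint
  have hcast : Qa a (below N p * p ^ 0) = Qa a (below N p) := by rw [h0]
  -- The norm is `q` times the discriminant, so Cramer's coefficients are multiplied by the integral
  -- `q`.
  refine ⟨fun i => q * c i, fun i => ⟨hcast ▸ mul_mem hq (c i).2, hqint.mul ?_⟩, ?_⟩
  · exact (hc i).map ((Qa a (below N p * p ^ 0)).val.restrictScalars ℤ)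
  · rw [stepNorm_eq a hN hp, hqe, mul_assoc]
    simp only [mul_assoc q]
    rw [← Finset.mul_sum, ← he]
    rfl

end Step

theorem filter_lt_succ_of_mem {N p : ℕ} (hp : p ∈ N.primeFactors) :
    (Finset.univ.filter fun q : N.primeFactors => (q : ℕ) < p + 1)
      = insert ⟨p, hp⟩ (Finset.univ.filter fun q : N.primeFactors => (q : ℕ) < p) := by
  ext q
  simp only [Finset.mem_filter, Finset.mem_univ, true_and, Finset.mem_insert, Subtype.ext_iff]
  omega

theorem filter_lt_succ_of_notMem {N p : ℕ} (hp : p ∉ N.primeFactors) :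
    (Finset.univ.filter fun q : N.primeFactors => (q : ℕ) < p + 1)
      = Finset.univ.filter fun q : N.primeFactors => (q : ℕ) < p := by
  refine Finset.filter_congr fun q _ => ?_
  have : (q : ℕ) ≠ p := fun h => hp (h ▸ q.2)
  omega

theorem totient_mul_le_finrank_below (a : ℕ) {N : ℕ} [NeZero a] (hN : Squarefree N)
    (hd : ∀ p, stepNorm a N p ≠ 0) (t : ℕ) :
    (below N t).totient * below N t ≤ Module.finrank ℚ (Qa a (below N t)) := by
  induction t with
  | zero => rw [below_zero, Qa_one, IntermediateField.finrank_bot]; simp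
  | succ t ih =>
    by_cases ht : t ∈ N.primeFactors
    · have hp := Nat.prime_of_mem_primeFactors ht
      rw [below_succ_of_mem hN ht, Nat.totient_mul (below_coprime hp), Nat.totient_prime hp]
      refine le_trans ?_ (finrank_step a hN ht (hd _))
      calc _ = (below N t).totient * below N t * ((t - 1) * t) := by ring
        _ ≤ _ := Nat.mul_le_mul_right _ ih
    · rwa [below_succ_of_notMem ht]

/-- Using rational norms rather than the discriminants lets the factors of the lower steps act on
the integral coefficients of the top step, where induction applies. -/
theorem prod_stepNorm_mul_mem (a : ℕ) {N : ℕ} [NeZero a] (hN : Squarefree N)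
    (hd : ∀ p, stepNorm a N p ≠ 0) (t : ℕ) {x : ℂ} (hx : x ∈ Qa a (below N t))
    (hint : IsIntegral ℤ x) :
    ((∏ p ∈ Finset.univ.filter fun q : N.primeFactors => (q : ℕ) < t, stepNorm a N p : ℚ) : ℂ) * x ∈ radicalRing a N := by
  induction t generalizing x with
  | zero =>
    rw [below_zero] at hx
    obtain ⟨c, rfl⟩ := exists_int_of_mem_Qa_one hx hint
    simp [intCast_mem]
  | succ t ih =>
    by_cases ht : t ∈ N.primeFactors
    · rw [below_succ_of_mem hN ht] at hx
      obtain ⟨c, hc, he⟩ := stepNorm_mul a hN ht (hd _) hx hint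
      rw [filter_lt_succ_of_mem ht, Finset.prod_insert (by simp), mul_comm (stepNorm a N _),
        Rat.cast_mul, mul_assoc, he, Finset.mul_sum]
      have htN := Nat.dvd_of_mem_primeFactors ht
      refine sum_mem fun i _ => ?_
      rw [← mul_assoc]
      exact mul_mem (ih (hc i).1 (hc i).2) (mul_mem
        (pow_mem (zeta_mem_radicalRing_of_dvd a htN hN.ne_zero) _)
        (realRoot_mem_radicalRing_of_dvd a htN hN.ne_zero _))
    · rw [filter_lt_succ_of_notMem ht]
      rw [below_succ_of_notMem ht] at hx
      exact ih hx hint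

theorem Delta_mul_mem_radicalRing (a : ℕ) {N : ℕ} [NeZero a] (ha : a ≠ 1) (hN : Squarefree N)
    (hΔ : Delta a N ≠ 0) {x : ℂ} (hx : x ∈ Qa a N) (hint : IsIntegral ℤ x) :
    N.totient * N ≤ Module.finrank ℚ (Qa a N) ∧ (Delta a N : ℂ) * x ∈ radicalRing a N := by
  rw [Delta, if_neg ha, norm_discProd] at *
  have hd : ∀ p, stepNorm a N p ≠ 0 := fun p =>
    Finset.prod_ne_zero_iff.1 (abs_ne_zero.1 hΔ) p (Finset.mem_univ p)
  have hb := below_eq_self hN.ne_zero (Nat.lt_succ_self N)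
  refine ⟨hb ▸ totient_mul_le_finrank_below a hN hd (N + 1), ?_⟩
  have h := prod_stepNorm_mul_mem a hN hd (N + 1) (hb.symm ▸ hx) hint
  rw [Finset.filter_true_of_mem fun (p : N.primeFactors) _ =>
    (Nat.le_of_mem_primeFactors p.2).trans_lt (Nat.lt_succ_self N)] at h
  -- The absolute value costs at most a sign, and a ring is closed under negation.
  rcases abs_choice (∏ p : N.primeFactors, stepNorm a N p) with h' | h' <;> rw [h']
  · exact h
  · rw [Rat.cast_neg, neg_mul]
    exact neg_mem h

/-! ### Assembling the bound -/

theorem meanSq_ratCast_mul (q : ℚ) (x : ℂ) (hx : IsIntegral ℚ x) :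
    meanSq ((q : ℂ) * x) = (q : ℝ) ^ 2 * meanSq x := by
  have := IntermediateField.adjoin.finiteDimensional hx
  set K := IntermediateField.adjoin ℚ {x}
  let y : K := IntermediateField.AdjoinSimple.gen ℚ x
  have h1 := finrank_mul_meanSq K y
  -- Both mean squares are averaged over the embeddings of `ℚ(x)`, so the case `q = 0`, where the
  -- degree drops, needs no separate argument.
  have h2 := finrank_mul_meanSq K (algebraMap ℚ K q * y)
  have hy : ((algebraMap ℚ K q * y : K) : ℂ) = (q : ℂ) * x := rfl
  rw [hy] at h2
  have h3 : ∀ σ : K →ₐ[ℚ] ℂ, ‖σ (algebraMap ℚ K q * y)‖ ^ 2 = (q : ℝ) ^ 2 * ‖σ y‖ ^ 2 := by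
    intro σ
    rw [map_mul, AlgHom.commutes, norm_mul, mul_pow, eq_ratCast, Complex.norm_ratCast, sq_abs]
  rw [Finset.sum_congr rfl fun σ _ => h3 σ, ← Finset.mul_sum, ← h1] at h2
  have hy' : ((y : K) : ℂ) = x := rfl
  rw [hy'] at h2
  have h0 : (Module.finrank ℚ K : ℝ) ≠ 0 := Nat.cast_ne_zero.2 Module.finrank_pos.ne'
  refine mul_left_cancel₀ h0 (h2.trans ?_)
  ring

theorem isSumOfRoots_of_eq_sum {a N : ℕ} [NeZero a] {β : ℂ} {x : Fin N → ℂ} {n : Fin N → ℕ}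
    (h : (Delta a N : ℂ) * β = ∑ j, x j * ((realRoot a N j : ℝ) : ℂ))
    (hx : ∀ j, IsSumOfUnityRoots (n j) (x j)) : IsSumOfRoots a N β (∑ j, n j) := by
  choose ξ hξ hx using hx
  refine ⟨fun i => ξ _ (finSigmaFinEquiv.symm i).2, fun i => (finSigmaFinEquiv.symm i).1,
    fun i => hξ _ _, ?_⟩
  rw [h, Equiv.sum_comp finSigmaFinEquiv.symm
    (fun s : (j : Fin N) × Fin (n j) => ξ s.1 s.2 * ((realRoot a N s.1 : ℝ) : ℂ)),
    Fintype.sum_sigma]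
  refine Finset.sum_congr rfl fun j _ => ?_
  rw [hx j, Finset.sum_mul]

/-- `Delta a N * β` is a combination of the `a ^ (j / N)` over `ℤ[ζ_N]`, and the mean squares of the
coefficients add up to at most the mean square of `Delta a N * β`. -/
theorem exists_eq_sum_of_isIntegral {a N : ℕ} [NeZero a] (hN : Squarefree N)
    (hΔ : Delta a N ≠ 0) {β : ℂ} (hβ : β ∈ Qa a N) (hint : IsIntegral ℤ β) :
    ∃ P : Fin N → ℤ[X],
      (Delta a N : ℂ) * β = ∑ j, aeval (zeta N) (P j) * ((realRoot a N j : ℝ) : ℂ) ∧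
      ∑ j, ∑ z ∈ primitiveRoots N ℂ, ‖aeval z (P j)‖ ^ 2
        ≤ N.totient * ((Delta a N : ℝ) ^ 2 * meanSq β) := by
  rw [← meanSq_ratCast_mul _ _ hint.tower_top]
  by_cases ha : a = 1
  · subst ha
    obtain ⟨P, rfl⟩ := exists_aeval_zeta_of_isIntegral hN.ne_zero hβ hint
    have : NeZero N := ⟨hN.ne_zero⟩
    refine ⟨fun j => if j = 0 then P else 0, ?_, ?_⟩
    · rw [Finset.sum_eq_single 0]
      · simp [Delta, realRoot]
      · intro j _ hj
        simp [hj]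
      · simp
    · rw [Delta, if_pos rfl, Rat.cast_one, one_mul, totient_mul_meanSq_aeval_zeta hN.ne_zero,
        Finset.sum_eq_single 0]
      · simp
      · intro j _ hj
        simp [hj]
      · simp
  · obtain ⟨hdim, hmem⟩ := Delta_mul_mem_radicalRing a ha hN hΔ hβ hint
    obtain ⟨P, hP⟩ := exists_sum_of_mem_radicalRing a hN.ne_zero hmem
    exact ⟨P, hP, hP ▸ le_meanSq_sum_realRoot a hN.ne_zero hdim P⟩

/-- The bound for a product `N` of distinct primes, without any hypothesis on `a`: if some step of
the tower has too small a degree, then `Delta a N = 0` and there is nothing to prove, and otherwise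
the nonvanishing of the discriminants provides all the degrees that the argument needs. -/
theorem exists_isSumOfRoots_le {p : ℕ → ℕ} (hp : ∀ r, (p r).Prime) (hinj : Function.Injective p)
    {a : ℕ} [NeZero a] {μ N : ℕ} (hN : N = ∏ r ∈ range μ, p r) {β : ℂ} (hβ : β ∈ Qa a N)
    (hint : IsIntegral ℤ β) :
    ∃ n : ℕ, IsSumOfRoots a N β n ∧ (n : ℝ) ≤ 2 ^ μ * ((Delta a N : ℝ) ^ 2 * meanSq β) := by
  by_cases hΔ : Delta a N = 0
  · exact ⟨0, ⟨Fin.elim0, Fin.elim0, fun i => i.elim0, by simp [hΔ]⟩, by simp [hΔ]⟩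
  have hsq : Squarefree N := by
    rw [hN]
    refine Finset.squarefree_prod_of_pairwise_isCoprime ?_ fun r _ => (hp r).prime.squarefree
    intro r _ s _ hrs
    exact Nat.coprime_iff_isRelPrime.1 ((Nat.coprime_primes (hp r) (hp s)).2 (hinj.ne hrs))
  obtain ⟨P, hP, hle⟩ := exists_eq_sum_of_isIntegral hsq hΔ hβ hint
  have hz : zeta N ∈ primitiveRoots N ℂ :=
    (mem_primitiveRoots (Nat.pos_of_ne_zero hsq.ne_zero)).2 (isPrimitiveRoot_zeta hsq.ne_zero)
  have key : ∀ j, ∃ n : ℕ, IsSumOfUnityRoots n (aeval (zeta N) (P j)) ∧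
      (n : ℝ) * (N.totient : ℝ) ≤ 2 ^ μ * ∑ w ∈ primitiveRoots N ℂ, ‖aeval w (P j)‖ ^ 2 := by
    subst hN
    exact fun j => exists_isSumOfUnityRoots_aeval hp hinj μ (P j) hz
  choose n hn hn' using key
  refine ⟨∑ j, n j, isSumOfRoots_of_eq_sum hP hn, ?_⟩
  have hφ : (0 : ℝ) < N.totient := by
    exact_mod_cast Nat.totient_pos.2 (Nat.pos_of_ne_zero hsq.ne_zero)
  refine le_of_mul_le_mul_right ?_ hφ
  calc ((∑ j, n j : ℕ) : ℝ) * N.totient = ∑ j, (n j : ℝ) * N.totient := by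
        push_cast
        rw [Finset.sum_mul]
    _ ≤ ∑ j, 2 ^ μ * ∑ w ∈ primitiveRoots N ℂ, ‖aeval w (P j)‖ ^ 2 :=
        Finset.sum_le_sum fun j _ => hn' j
    _ ≤ 2 ^ μ * (N.totient * ((Delta a N : ℝ) ^ 2 * meanSq β)) := by
        rw [← Finset.mul_sum]
        gcongr
    _ = _ := by ring

end Kummer

theorem lemma5p2 (a : ℕ) [NeZero a]
    (ha : a = 1 ∨ ¬ ∃ (q : ℚ) (k : ℕ), 2 ≤ k ∧ (a : ℚ) = q ^ k)
    (μ N : ℕ) (hN : N = ∏ r ∈ Finset.range μ, Nat.nth Nat.Prime (r + 1))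
    (β : ℂ) (hβ : β ∈ Kummer.Qa a N) (hint : IsIntegral ℤ β) :
    (∃ n : ℕ, Kummer.IsSumOfRoots a N β n) ∧
      (2 : ℝ)⁻¹ ^ μ * (Kummer.M a N β : ℝ) ≤
        (Kummer.Delta a N : ℝ) ^ 2 * Kummer.meanSq β := by
  obtain ⟨n, hn, hle⟩ := Kummer.exists_isSumOfRoots_le
    -- `Nat.nth` counts from `0`, with value `2` there; the shift starts the list at `3`.
    (p := fun r => Nat.nth Nat.Prime (r + 1)) (fun r => Nat.prime_nth_prime _)
    (fun r s h => Nat.succ_injective (Nat.nth_injective Nat.infinite_setOfPred_prime h)) hN hβ hint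
  refine ⟨⟨n, hn⟩, ?_⟩
  have hM : (Kummer.M a N β : ℝ) ≤ n := Nat.cast_le.2 (Nat.sInf_le hn)
  rw [inv_pow, inv_mul_le_iff₀ (by positivity)]
  exact hM.trans hle
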